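/- All graphs are finite, simple, undirected and have at least one vertex. For a graph $F$ and a positive integer $k$, a proper $[k]$-total coloring of $F$ is a map $c: V(F)\cup E(F)\to\{1,2,\dots,k\}$ such that adjacent vertices, distinct edges sharing an endpoint, and a vertex and an edge incident with it always receive different colors. For $v\in V(F)$ let $\prod(v)$ be the product of $c(v)$ and the colors of all edges incident with $v$. The coloring is neighbor product distinguishing if $\prod(u)\neq\prod(v)$ for every edge $uv\in E(F)$, and $\chi''_{\prod}(F)$ denotes the smallest $k$ for which such a coloring of $F$ exists. The corona product $G\circ H$ is obtained from one copy of $G$ and, for each vertex $v$ of $G$, one copy $H_v$ of $H$, by joining $v$ to every vertex of $H_v$. **Theorem 1.** Let $G$ and $H$ be any two subcubic graphs (maximum degree at most $3$). Then $$\chi''_{\prod}(G\circ H)\le\Delta(G\circ H)+3 ,$$ where $\Delta$ denotes the maximum degree. -/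

import Mathlib

namespace SimpleGraph

/-- The corona product of `G` and `H`: one copy of `G` (the vertices `inl v`), for each vertex `v`
of `G` a copy of `H` (the vertices `inr (v, w)`), and edges joining `v` to every vertex of its own
copy of `H`. -/
def corona {V W : Type*} (G : SimpleGraph V) (H : SimpleGraph W) :
    SimpleGraph (V ⊕ V × W) where
  Adj
    | .inl v, .inl v' => G.Adj v v'
    | .inl v, .inr p => v = p.1
    | .inr p, .inl v => p.1 = v
    | .inr p, .inr q => p.1 = q.1 ∧ H.Adj p.2 q.2
  symm := ⟨by
    rintro (v | p) (v' | q) h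
    · exact G.adj_symm h
    · exact Eq.symm h
    · exact Eq.symm h
    · exact ⟨h.1.symm, H.adj_symm h.2⟩⟩
  loopless := ⟨by
    rintro (v | p) h
    · exact G.irrefl h
    · exact H.irrefl h.2⟩

instance {V W : Type*} [DecidableEq V] (G : SimpleGraph V) [DecidableRel G.Adj]
    (H : SimpleGraph W) [DecidableRel H.Adj] : DecidableRel (G.corona H).Adj
  | .inl v, .inl v' => inferInstanceAs (Decidable (G.Adj v v'))
  | .inl v, .inr p => inferInstanceAs (Decidable (v = p.1))
  | .inr p, .inl v => inferInstanceAs (Decidable (p.1 = v))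
  | .inr p, .inr q => inferInstanceAs (Decidable (p.1 = q.1 ∧ H.Adj p.2 q.2))

/-- `f` (colors of the vertices) and `g` (colors of the edges) form a proper total coloring of `G`
with colors in `{1, …, k}`: adjacent vertices, distinct edges with a common endpoint, and incident
vertex-edge pairs get different colors. The values of `g` at pairs that are not edges of `G` play
no role. -/
structure IsTotalColoring {V : Type*} (G : SimpleGraph V) (k : ℕ) (f : V → ℕ) (g : Sym2 V → ℕ) :
    Prop where
  vertex_mem : ∀ v, f v ∈ Finset.Icc 1 k
  edge_mem : ∀ e ∈ G.edgeSet, g e ∈ Finset.Icc 1 k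
  vertex_ne : ∀ u v, G.Adj u v → f u ≠ f v
  edge_ne : ∀ e ∈ G.edgeSet, ∀ e' ∈ G.edgeSet, e ≠ e' → (∃ v, v ∈ e ∧ v ∈ e') → g e ≠ g e'
  incident_ne : ∀ v, ∀ e ∈ G.edgeSet, v ∈ e → f v ≠ g e

/-- The product of the color of `v` and the colors of all edges incident with `v`. -/
def colorProd {V : Type*} [Fintype V] [DecidableEq V] (G : SimpleGraph V) [DecidableRel G.Adj]
    (f : V → ℕ) (g : Sym2 V → ℕ) (v : V) : ℕ :=
  f v * ∏ e ∈ G.incidenceFinset v, g e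

/-- A neighbor product distinguishing total coloring of `G` with colors in `{1, …, k}`. -/
structure IsNPDTotalColoring {V : Type*} [Fintype V] [DecidableEq V] (G : SimpleGraph V)
    [DecidableRel G.Adj] (k : ℕ) (f : V → ℕ) (g : Sym2 V → ℕ) : Prop
    extends G.IsTotalColoring k f g where
  prod_ne : ∀ u v, G.Adj u v → G.colorProd f g u ≠ G.colorProd f g v

/-- The neighbor product distinguishing total chromatic number `χ''_∏(G)`: the least positive
integer `k` such that `G` has a neighbor product distinguishing total coloring with colors in
`{1, …, k}` (and `⊤` if there were no such `k`). -/
noncomputable def npdTotalChromaticNumber {V : Type*} [Fintype V] [DecidableEq V]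
    (G : SimpleGraph V) [DecidableRel G.Adj] : ℕ∞ :=
  ⨅ (k : ℕ) (_ : 0 < k ∧ ∃ f g, G.IsNPDTotalColoring k f g), (k : ℕ∞)

end SimpleGraph

/-! Write n for the order of H, d = Δ(G), D = Δ(H). A base vertex of degree d has degree d + n in
the corona, so k = n + d + 3 colors suffice to prove the bound. The product at a base vertex v sees
its copy of H only through the set P v of colors on the n spokes from v. So the problem splits:
first color G together with the sets P v so that adjacent base vertices have different products
(`IsSpokeColoring`); then color each copy separately, distributing the colors of P v over the spokes
and avoiding the color and the product t of v (`HasCopyColoring`).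
`exists_isNPDTotalColoring_corona` glues the pieces.

For the base, color edges and vertices greedily. At least two more colors than needed are then left
for the spokes at v, and varying the spoke set yields enough different products to avoid those at
the neighbors (`exists_isSpokeColoring`). Only n = 1, d = 3 escapes this count; there the vertex
color and the single spoke color are chosen for two adjacent vertices at a time
(`exists_isSpokeColoring_one`).

For a copy, color edges greedily, then vertices. A neighbor forbids two values, its color and the
one that equalizes the products, but coloring two adjacent vertices together makes lists of size
twice the degree sufficient (`exists_list_coloring`). This settles k ≥ 3D + 3
(`hasCopyColoring_of_le`). For slightly smaller k, Bertrand's postulate gives a prime p with k/2 < p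
≤ k. Since p divides no other color, placing p on a maximal independent set and on one spoke
separates most products by divisibility and lowers the remaining degree
(`hasCopyColoring_of_prime`).

What remains has n ≤ 6. There an explicit coloring of the complete graph on n vertices works for
every subcubic H at once, as a finite check confirms (`hasCopyColoring_of_universal`), with spoke
colorings of G adapted to these tables. -/

namespace SimpleGraph

/-- The product of the values of `g` on the edges at `v`. -/
def nbrProd {V : Type*} [Fintype V] (G : SimpleGraph V) [DecidableRel G.Adj]
    (g : Sym2 V → ℕ) (v : V) : ℕ :=
  ∏ a ∈ G.neighborFinset v, g s(v, a)

theorem colorProd_eq {V : Type*} [Fintype V] [DecidableEq V] (G : SimpleGraph V)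
    [DecidableRel G.Adj] (f : V → ℕ) (g : Sym2 V → ℕ) (v : V) :
    G.colorProd f g v = f v * G.nbrProd g v := by
  have h : G.incidenceFinset v = (G.neighborFinset v).image (fun a => s(v, a)) := by
    ext e
    induction e with | _ x y
    simp only [mem_incidenceFinset, mk'_mem_incidenceSet_iff, Finset.mem_image,
      mem_neighborFinset, Sym2.eq_iff]
    constructor
    · rintro ⟨h, rfl | rfl⟩
      · exact ⟨y, h, by simp⟩
      · exact ⟨x, h.symm, by simp⟩
    · rintro ⟨a, h, ⟨rfl, rfl⟩ | ⟨rfl, rfl⟩⟩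
      · exact ⟨h, by simp⟩
      · exact ⟨h.symm, by simp⟩
  rw [colorProd, nbrProd, h, Finset.prod_image]
  intro a _ b _ hab
  exact Sym2.congr_right.1 hab

theorem nbrProd_pos {V : Type*} [Fintype V] (G : SimpleGraph V) [DecidableRel G.Adj]
    {g : Sym2 V → ℕ} {v : V} (h : ∀ a, G.Adj v a → 0 < g s(v, a)) : 0 < G.nbrProd g v :=
  Finset.prod_pos fun a ha => h a (by simpa using ha)

/-! ### Sequential choice and greedy list colorings -/

/-- Sequential choice: if every vertex can be given a value compatible with any values of its
neighbors, then there is a globally compatible assignment. -/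
theorem exists_assignment_of_extension {α β : Type*} [Fintype α] [Nonempty β] (K : SimpleGraph α)
    (L : α → β → Prop) (ok : α → β → α → β → Prop)
    (hsymm : ∀ a x b y, ok a x b y → ok b y a x)
    (h : ∀ φ : α → β, ∀ u, ∃ x, L u x ∧ ∀ w, K.Adj u w → ok u x w (φ w)) :
    ∃ φ : α → β, (∀ a, L a (φ a)) ∧ ∀ a b, K.Adj a b → ok a (φ a) b (φ b) := by
  classical
  suffices H : ∀ U : Finset α, ∃ φ : α → β, (∀ a ∈ U, L a (φ a)) ∧
      ∀ a ∈ U, ∀ b ∈ U, K.Adj a b → ok a (φ a) b (φ b) by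
    obtain ⟨φ, h1, h2⟩ := H Finset.univ
    exact ⟨φ, fun a => h1 a (by simp), fun a b => h2 a (by simp) b (by simp)⟩
  intro U
  induction U using Finset.induction with
  | empty =>
    exact ⟨fun _ => Classical.arbitrary β, by simp, by simp⟩
  | insert u U hu ih =>
    obtain ⟨φ, h1, h2⟩ := ih
    obtain ⟨x, hx, hx'⟩ := h φ u
    have hne : ∀ a ∈ U, a ≠ u := fun a ha e => hu (e ▸ ha)
    refine ⟨Function.update φ u x, ?_, ?_⟩
    · intro a ha
      rcases Finset.mem_insert.1 ha with rfl | ha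
      · simpa using hx
      · simpa [Function.update_of_ne (hne a ha)] using h1 a ha
    · intro a ha b hb hab
      by_cases hau : a = u
      · have hbu : b ≠ u := fun h => hab.ne (hau.trans h.symm)
        subst hau
        rw [Function.update_self, Function.update_of_ne hbu]
        exact hx' b hab
      · have ha' := (Finset.mem_insert.1 ha).resolve_left hau
        by_cases hbu : b = u
        · subst hbu
          rw [Function.update_self, Function.update_of_ne hau]
          exact hsymm _ _ _ _ (hx' a hab.symm)
        · rw [Function.update_of_ne hbu, Function.update_of_ne hau]
          exact h2 a ha' b ((Finset.mem_insert.1 hb).resolve_left hbu) hab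

/-- Sequential choice for pairs: if any two adjacent vertices can be given values compatible with
each other and with any values of their other neighbors, then there is a globally compatible
assignment. -/
theorem exists_assignment_of_pair_extension {α β : Type*} [Fintype α] (K : SimpleGraph α)
    (L : α → β → Prop) (ok : α → β → α → β → Prop)
    (hsymm : ∀ a x b y, ok a x b y → ok b y a x) (hne : ∀ a, ∃ x, L a x)
    (h : ∀ φ : α → β, ∀ u v, K.Adj u v → ∃ x y, L u x ∧ L v y ∧ ok u x v y ∧
      (∀ w, K.Adj u w → w ≠ v → ok u x w (φ w)) ∧ (∀ w, K.Adj v w → w ≠ u → ok v y w (φ w))) :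
    ∃ φ : α → β, (∀ a, L a (φ a)) ∧ ∀ a b, K.Adj a b → ok a (φ a) b (φ b) := by
  classical
  suffices H : ∀ U : Finset α, ∃ φ : α → β, (∀ a ∈ U, L a (φ a)) ∧
      ∀ a ∈ U, ∀ b ∈ U, K.Adj a b → ok a (φ a) b (φ b) by
    obtain ⟨φ, h1, h2⟩ := H Finset.univ
    exact ⟨φ, fun a => h1 a (by simp), fun a b => h2 a (by simp) b (by simp)⟩
  intro U
  induction U using Finset.strongInduction with
  | H U ih =>
    by_cases hU : ∃ u ∈ U, ∃ v ∈ U, K.Adj u v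
    · obtain ⟨u, hu, v, hv, huv⟩ := hU
      obtain ⟨φ, h1, h2⟩ := ih ((U.erase u).erase v)
        ((Finset.erase_subset _ _).trans_ssubset (Finset.erase_ssubset hu))
      obtain ⟨x, y, hx, hy, hxy, hx', hy'⟩ := h φ u v huv
      have huv' : u ≠ v := huv.ne
      let ψ := Function.update (Function.update φ u x) v y
      have ψv : ψ v = y := by simp [ψ]
      have ψu : ψ u = x := by simp [ψ, huv']
      have ψo : ∀ a, a ≠ u → a ≠ v → ψ a = φ a := fun a hau hav => by simp [ψ, hau, hav]
      have key : ∀ a b, a ∈ U → b ∈ U → K.Adj a b → (a = u ∨ a = v) →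
          ok a (ψ a) b (ψ b) := by
        rintro a b ha hb hab (rfl | rfl)
        · by_cases hbv : b = v
          · subst hbv; rw [ψv, ψu]; exact hxy
          · rw [ψu, ψo b hab.ne' hbv]; exact hx' b hab hbv
        · by_cases hbu : b = u
          · subst hbu; rw [ψv, ψu]; exact hsymm _ _ _ _ hxy
          · rw [ψv, ψo b hbu hab.ne']; exact hy' b hab hbu
      refine ⟨ψ, ?_, ?_⟩
      · intro a ha
        by_cases hau : a = u
        · subst hau; rwa [ψu]
        by_cases hav : a = v
        · subst hav; rwa [ψv]
        rw [ψo a hau hav]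
        exact h1 a (by simp [hau, hav, ha])
      · intro a ha b hb hab
        by_cases ha' : a = u ∨ a = v
        · exact key a b ha hb hab ha'
        by_cases hb' : b = u ∨ b = v
        · exact hsymm _ _ _ _ (key b a hb ha hab.symm hb')
        push Not at ha' hb'
        rw [ψo a ha'.1 ha'.2, ψo b hb'.1 hb'.2]
        exact h2 a (by simp [ha', ha]) b (by simp [hb', hb]) hab
    · push Not at hU
      choose φ hφ using hne
      exact ⟨φ, fun a _ => hφ a, fun a ha b hb hab => absurd hab (hU a ha b hb)⟩

/-- Two pairs of values can be matched so that both the values and their multiples by fixed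
factors differ. -/
theorem exists_ne_mul_ne {A B : Finset ℕ} (hA : 2 ≤ A.card) (hB : 2 ≤ B.card) {α β : ℕ}
    (hα : 0 < α) (hβ : 0 < β) (hA0 : 0 ∉ A) : ∃ x ∈ A, ∃ y ∈ B, x ≠ y ∧ α * x ≠ β * y := by
  obtain ⟨x, hx, x', hx', hxx⟩ := Finset.one_lt_card.1 hA
  obtain ⟨y, hy, y', hy', hyy⟩ := Finset.one_lt_card.1 hB
  -- Each of the relations x = y and αx = βy is a partial matching between two values of A and two
  -- of B. If together they cover all four pairs, they are the two complementary perfect matchings,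
  -- so αx = βx' and αx' = βx, which multiply to x² = x'².
  by_contra! hcon
  have e1 := hcon x hx y hy
  have e2 := hcon x hx y' hy'
  have e3 := hcon x' hx' y hy
  have e4 := hcon x' hx' y' hy'
  have cβ : ∀ {p q}, β * p = β * q → p = q := fun h => Nat.eq_of_mul_eq_mul_left hβ h
  have cα : ∀ {p q}, α * p = α * q → p = q := fun h => Nat.eq_of_mul_eq_mul_left hα h
  have x0 : 0 < x := Nat.pos_of_ne_zero fun h => hA0 (h ▸ hx)
  have x0' : 0 < x' := Nat.pos_of_ne_zero fun h => hA0 (h ▸ hx')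
  have swap : ∀ {p q : ℕ}, 0 < p → 0 < q → α * p = β * q → α * q = β * p → p = q := by
    intro p q hp hq h1 h2
    have h3 : α * β * (p * p) = α * β * (q * q) := by
      calc α * β * (p * p) = (α * p) * (β * p) := by ring
        _ = (β * q) * (α * q) := by rw [h1, h2]
        _ = _ := by ring
    have h4 := Nat.eq_of_mul_eq_mul_left (Nat.mul_pos hα hβ) h3
    exact Nat.mul_self_inj.1 h4
  by_cases h1 : x = y
  · have h2 : x ≠ y' := fun h => hyy (h1.symm.trans h)
    have h3 : x' ≠ y := fun h => hxx (h1.trans h.symm)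
    by_cases h4 : x' = y'
    · subst h1 h4
      exact hxx (swap x0 x0' (e2 h2) (e3 h3))
    · exact hyy (cβ ((e3 h3).symm.trans (e4 h4)))
  · by_cases h2 : x = y'
    · by_cases h3 : x' = y
      · subst h2 h3
        exact hxx (swap x0 x0' (e1 h1) (e4 hxx.symm))
      · exact hxx (cα ((e1 h1).trans (e3 h3).symm))
    · exact hyy (cβ ((e1 h1).symm.trans (e2 h2)))

/-- If `|L u| ≥ max(1, 2 deg u)` for all `u`, then one can choose values in the lists `L u` such
that adjacent vertices get different values and different multiples by the factors `κ`. -/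
theorem exists_list_coloring {W : Type*} [Fintype W] [DecidableEq W] (K : SimpleGraph W)
    [DecidableRel K.Adj] (L : W → Finset ℕ) (κ : W → ℕ) (hκ : ∀ w, 0 < κ w)
    (h0 : ∀ w, 0 ∉ L w) (hne : ∀ w, (L w).Nonempty) (hL : ∀ w, 2 * K.degree w ≤ (L w).card) :
    ∃ f : W → ℕ, (∀ w, f w ∈ L w) ∧ ∀ a b, K.Adj a b → f a ≠ f b ∧ κ a * f a ≠ κ b * f b := by
  refine exists_assignment_of_pair_extension K (fun w x => x ∈ L w)
    (fun a x b y => x ≠ y ∧ κ a * x ≠ κ b * y) (fun a x b y h => ⟨h.1.symm, h.2.symm⟩) hne ?_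
  intro φ u v huv
  have key : ∀ u v, K.Adj u v → ∃ A ⊆ L u, 2 ≤ A.card ∧
      ∀ x ∈ A, ∀ w, K.Adj u w → w ≠ v → x ≠ φ w ∧ κ u * x ≠ κ w * φ w := by
    intro u v huv
    -- Each of the deg u - 1 neighbors other than v forbids at most two values, so two remain. The
    -- truncated quotient is the forbidden value whenever there is one; otherwise it only removes a
    -- harmless extra value. The same device recurs below.
    refine ⟨L u \ (((K.neighborFinset u).erase v).image φ ∪
      ((K.neighborFinset u).erase v).image fun w => κ w * φ w / κ u), Finset.sdiff_subset, ?_, ?_⟩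
    · have hc : ((K.neighborFinset u).erase v).card = K.degree u - 1 := by
        rw [Finset.card_erase_of_mem (by simpa using huv), card_neighborFinset_eq_degree]
      have h1 := Finset.le_card_sdiff (((K.neighborFinset u).erase v).image φ ∪
        ((K.neighborFinset u).erase v).image fun w => κ w * φ w / κ u) (L u)
      have h2 := Finset.card_union_le (((K.neighborFinset u).erase v).image φ)
        (((K.neighborFinset u).erase v).image fun w => κ w * φ w / κ u)
      have h3 : (((K.neighborFinset u).erase v).image φ).card ≤ _ := Finset.card_image_le
      have h4 : (((K.neighborFinset u).erase v).image fun w => κ w * φ w / κ u).card ≤ _ :=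
        Finset.card_image_le
      have h5 := hL u
      have h6 : 0 < K.degree u := (K.degree_pos_iff_exists_adj u).2 ⟨v, huv⟩
      omega
    · intro x hx w huw hwv
      simp only [Finset.mem_sdiff, Finset.mem_union, Finset.mem_image, Finset.mem_erase,
        mem_neighborFinset, not_or, not_exists, not_and] at hx
      refine ⟨fun h => hx.2.1 w ⟨hwv, huw⟩ h.symm, fun h => hx.2.2 w ⟨hwv, huw⟩ ?_⟩
      rw [← h, Nat.mul_div_cancel_left _ (hκ u)]
  obtain ⟨A, hAL, hA, hA'⟩ := key u v huv
  obtain ⟨B, hBL, hB, hB'⟩ := key v u huv.symm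
  obtain ⟨x, hx, y, hy, hxy⟩ := exists_ne_mul_ne hA hB (hκ u) (hκ v) (fun h => h0 u (hAL h))
  exact ⟨x, y, hAL hx, hBL hy, hxy, hA' x hx, hB' y hy⟩

/-- Greedy edge coloring from lists, where in addition at prescribed vertices the product of the
colors avoids a prescribed value. -/
theorem exists_edge_coloring {W : Type*} [Fintype W] [DecidableEq W] (H : SimpleGraph W)
    [DecidableRel H.Adj] {D : ℕ} (hD : ∀ w, H.degree w ≤ D) (L : Sym2 W → Finset ℕ)
    (Z : Finset W) (κ t : W → ℕ) (hκ : ∀ w, 0 < κ w) (hZ : ∀ z ∈ Z, ∃ a, H.Adj z a)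
    (h0 : ∀ e, 0 ∉ L e)
    (hL : ∀ a b, H.Adj a b → 2 * (D - 1) + (({a, b} : Finset W) ∩ Z).card < (L s(a, b)).card) :
    ∃ g : Sym2 W → ℕ, (∀ e ∈ H.edgeSet, g e ∈ L e) ∧
      (∀ a b b', H.Adj a b → H.Adj a b' → b ≠ b' → g s(a, b) ≠ g s(a, b')) ∧
      ∀ z ∈ Z, κ z * H.nbrProd g z ≠ t z := by
  -- The product condition at z is demanded only once all edges at z are colored, so it costs a
  -- single forbidden color, at the last edge. By `hZ` there is such an edge.
  suffices claim : ∀ U : Finset (Sym2 W), ∃ g : Sym2 W → ℕ,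
      (∀ e ∈ U, e ∈ H.edgeSet → g e ∈ L e) ∧
      (∀ a b b', H.Adj a b → H.Adj a b' → b ≠ b' → s(a, b) ∈ U → s(a, b') ∈ U →
        g s(a, b) ≠ g s(a, b')) ∧
      ∀ z ∈ Z, (∀ a, H.Adj z a → s(z, a) ∈ U) → κ z * H.nbrProd g z ≠ t z by
    obtain ⟨g, h1, h2, h3⟩ := claim Finset.univ
    exact ⟨g, fun e he => h1 e (by simp) he,
      fun a b b' hb hb' hne => h2 a b b' hb hb' hne (by simp) (by simp),
      fun z hz => h3 z hz (by simp)⟩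
  intro U
  induction U using Finset.induction with
  | empty =>
    refine ⟨fun _ => 0, by simp, by simp, fun z hz h => ?_⟩
    obtain ⟨a, ha⟩ := hZ z hz
    simpa using h a ha
  | insert e U he ih =>
    obtain ⟨g, h1, h2, h3⟩ := ih
    by_cases hee : e ∈ H.edgeSet
    swap
    · have hmem : ∀ a b, H.Adj a b → s(a, b) ∈ insert e U → s(a, b) ∈ U := by
        intro a b hab hm
        refine (Finset.mem_insert.1 hm).resolve_left fun h => hee ?_
        rw [← h]; exact hab
      refine ⟨g, ?_, ?_, ?_⟩
      · intro e' he' hee'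
        refine h1 e' ((Finset.mem_insert.1 he').resolve_left fun h => hee (h ▸ hee')) hee'
      · intro a b b' hb hb' hne hm hm'
        exact h2 a b b' hb hb' hne (hmem _ _ hb hm) (hmem _ _ hb' hm')
      · intro z hz h
        exact h3 z hz fun a ha => hmem _ _ ha (h a ha)
    induction e with | _ a b
    have hab : H.Adj a b := hee
    let R : W → ℕ := fun z => ∏ x ∈ (H.neighborFinset z).filter (fun x => s(z, x) ≠ s(a, b)),
      g s(z, x)
    let F : Finset ℕ := (((H.neighborFinset a).erase b).image fun x => g s(a, x)) ∪
      (((H.neighborFinset b).erase a).image fun x => g s(b, x)) ∪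
      (({a, b} : Finset W) ∩ Z).image fun z => t z / (κ z * R z)
    have hF : F.card < (L s(a, b)).card := by
      have c1 : (((H.neighborFinset a).erase b).image fun x => g s(a, x)).card ≤ D - 1 := by
        refine Finset.card_image_le.trans ?_
        rw [Finset.card_erase_of_mem (by simpa using hab), card_neighborFinset_eq_degree]
        have := hD a
        omega
      have c2 : (((H.neighborFinset b).erase a).image fun x => g s(b, x)).card ≤ D - 1 := by
        refine Finset.card_image_le.trans ?_
        rw [Finset.card_erase_of_mem (by simpa using hab.symm), card_neighborFinset_eq_degree]
        have := hD b
        omega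
      have c3 : ((({a, b} : Finset W) ∩ Z).image fun z => t z / (κ z * R z)).card ≤ _ :=
        Finset.card_image_le
      have c4 : F.card ≤ _ := Finset.card_union_le _ _
      have c5 := Finset.card_union_le (((H.neighborFinset a).erase b).image fun x => g s(a, x))
        (((H.neighborFinset b).erase a).image fun x => g s(b, x))
      have := hL a b hab
      omega
    obtain ⟨x, hxL, hxF⟩ := Finset.exists_mem_notMem_of_card_lt_card hF
    simp only [F, Finset.mem_union, Finset.mem_image, Finset.mem_erase, mem_neighborFinset,
      not_or, not_exists, not_and, Finset.mem_inter, Finset.mem_insert,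
      Finset.mem_singleton] at hxF
    obtain ⟨⟨hxa, hxb⟩, hxz⟩ := hxF
    have hself : Function.update g s(a, b) x s(a, b) = x := by simp
    have hoth : ∀ e', e' ≠ s(a, b) → Function.update g s(a, b) x e' = g e' :=
      fun e' h => Function.update_of_ne h _ _
    have hxadj : ∀ p q q', s(p, q) = s(a, b) → H.Adj p q' → q ≠ q' → g s(p, q') ≠ x := by
      intro p q q' hpq hq' hne
      rcases Sym2.eq_iff.1 hpq with ⟨rfl, rfl⟩ | ⟨rfl, rfl⟩
      · exact hxa q' ⟨hne.symm, hq'⟩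
      · exact hxb q' ⟨hne.symm, hq'⟩
    refine ⟨Function.update g s(a, b) x, ?_, ?_, ?_⟩
    · intro e' he' hee'
      by_cases h : e' = s(a, b)
      · subst h; rwa [hself]
      · rw [hoth e' h]
        exact h1 e' ((Finset.mem_insert.1 he').resolve_left h) hee'
    · intro p q q' hq hq' hne hm hm'
      by_cases h : s(p, q) = s(a, b)
      · have h' : s(p, q') ≠ s(a, b) := by
          rw [← h]; intro h'; exact hne (Sym2.congr_right.1 h'.symm)
        rw [h, hself, hoth _ h']
        exact (hxadj p q q' h hq' hne).symm
      · by_cases h' : s(p, q') = s(a, b)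
        · rw [h', hself, hoth _ h]
          exact hxadj p q' q h' hq hne.symm
        · rw [hoth _ h, hoth _ h']
          exact h2 p q q' hq hq' hne ((Finset.mem_insert.1 hm).resolve_left h)
            ((Finset.mem_insert.1 hm').resolve_left h')
    · intro z hz hall
      by_cases hzab : z = a ∨ z = b
      · obtain ⟨o, ho, hzo⟩ : ∃ o, s(z, o) = s(a, b) ∧ H.Adj z o := by
          rcases hzab with rfl | rfl
          · exact ⟨b, rfl, hab⟩
          · exact ⟨a, Sym2.eq_swap, hab.symm⟩
        have hprod : H.nbrProd (Function.update g s(a, b) x) z = x * R z := by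
          rw [nbrProd, ← Finset.mul_prod_erase _ _ (show o ∈ H.neighborFinset z by simpa using hzo),
            ho, hself]
          congr 1
          have : (H.neighborFinset z).erase o =
              (H.neighborFinset z).filter (fun x => s(z, x) ≠ s(a, b)) := by
            ext y
            simp only [Finset.mem_erase, Finset.mem_filter, ← ho]
            rw [and_comm, ne_eq, ne_eq, Sym2.congr_right]
          rw [this]
          refine Finset.prod_congr rfl fun y hy => hoth _ (Finset.mem_filter.1 hy).2
        have hR : 0 < R z := by
          refine Finset.prod_pos fun y hy => ?_
          obtain ⟨hy1, hy2⟩ := Finset.mem_filter.1 hy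
          have hzy : H.Adj z y := by simpa using hy1
          have := h1 _ ((Finset.mem_insert.1 (hall y hzy)).resolve_left hy2) hzy
          exact Nat.pos_of_ne_zero fun h => h0 _ (h ▸ this)
        intro hcon
        refine hxz z ⟨hzab, hz⟩ ?_
        rw [← hcon, hprod, show κ z * (x * R z) = x * (κ z * R z) by ring]
        exact Nat.mul_div_cancel _ (Nat.mul_pos (hκ z) hR)
      · have hzne : ∀ y, s(z, y) ≠ s(a, b) := by
          intro y h
          rcases Sym2.eq_iff.1 h with ⟨h, -⟩ | ⟨h, -⟩
          · exact hzab (Or.inl h)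
          · exact hzab (Or.inr h)
        have : H.nbrProd (Function.update g s(a, b) x) z = H.nbrProd g z :=
          Finset.prod_congr rfl fun y _ => hoth _ (hzne y)
        rw [this]
        exact h3 z hz fun y hy => (Finset.mem_insert.1 (hall y hy)).resolve_left (hzne y)

/-! ### Splitting a corona into the base graph and its copies -/

theorem isNPDTotalColoring_of_adj {V : Type*} [Fintype V] [DecidableEq V] (G : SimpleGraph V)
    [DecidableRel G.Adj] {k : ℕ} {f : V → ℕ} {g : Sym2 V → ℕ} (hf : ∀ v, f v ∈ Finset.Icc 1 k)
    (hg : ∀ a b, G.Adj a b → g s(a, b) ∈ Finset.Icc 1 k)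
    (hff : ∀ a b, G.Adj a b → f a ≠ f b)
    (hgg : ∀ a b b', G.Adj a b → G.Adj a b' → b ≠ b' → g s(a, b) ≠ g s(a, b'))
    (hfg : ∀ a b, G.Adj a b → f a ≠ g s(a, b))
    (hprod : ∀ a b, G.Adj a b → f a * G.nbrProd g a ≠ f b * G.nbrProd g b) :
    G.IsNPDTotalColoring k f g where
  vertex_mem := hf
  edge_mem := by
    intro e he
    induction e with | _ a b
    exact hg a b he
  vertex_ne := hff
  edge_ne := by
    rintro e he e' he' hne ⟨v, hv, hv'⟩
    obtain ⟨a, rfl⟩ := hv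
    obtain ⟨b, rfl⟩ := hv'
    exact hgg v a b he he' fun h => hne (by rw [h])
  incident_ne := by
    rintro v e he hv
    obtain ⟨a, rfl⟩ := hv
    exact hfg v a he
  prod_ne := by
    intro u v huv
    rw [colorProd_eq, colorProd_eq]
    exact hprod u v huv

/-- `H` can be colored as the copy attached to a vertex `v` of color `c`, such that the edges
joining `v` to the copy get exactly the colors in `P`, and that the products in the copy differ
from `t`, the product at `v`. -/
def HasCopyColoring {W : Type*} [Fintype W] (H : SimpleGraph W)
    [DecidableRel H.Adj] (k c : ℕ) (P : Finset ℕ) (t : ℕ) : Prop :=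
  ∃ (f s : W → ℕ) (g : Sym2 W → ℕ),
    (∀ w, f w ∈ Finset.Icc 1 k ∧ f w ≠ c ∧ f w ≠ s w) ∧
    Function.Injective s ∧ Finset.univ.image s = P ∧
    (∀ a b, H.Adj a b → g s(a, b) ∈ Finset.Icc 1 k ∧ g s(a, b) ≠ s a ∧ g s(a, b) ≠ f a) ∧
    (∀ a b b', H.Adj a b → H.Adj a b' → b ≠ b' → g s(a, b) ≠ g s(a, b')) ∧
    (∀ a b, H.Adj a b → f a ≠ f b ∧
      f a * (s a * H.nbrProd g a) ≠ f b * (s b * H.nbrProd g b)) ∧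
    ∀ w, f w * (s w * H.nbrProd g w) ≠ t

/-- The product at `v` when `v` has color `c v`, the edges at `v` are colored by `g` and there are
additional edges at `v` with the colors in `P v`. -/
def spokeProd {V : Type*} [Fintype V] (G : SimpleGraph V) [DecidableRel G.Adj] (c : V → ℕ)
    (g : Sym2 V → ℕ) (P : V → Finset ℕ) (v : V) : ℕ :=
  c v * ((∏ x ∈ P v, x) * G.nbrProd g v)

/-- A total coloring of `G` together with sets `P v` of colors for additional edges at the
vertices `v`, such that adjacent vertices have different products. -/
structure IsSpokeColoring {V : Type*} [Fintype V] (G : SimpleGraph V) [DecidableRel G.Adj]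
    (k : ℕ) (c : V → ℕ) (g : Sym2 V → ℕ) (P : V → Finset ℕ) : Prop where
  vertex_mem : ∀ v, c v ∈ Finset.Icc 1 k
  edge_mem : ∀ a b, G.Adj a b → g s(a, b) ∈ Finset.Icc 1 k
  spoke_mem : ∀ v, P v ⊆ Finset.Icc 1 k
  vertex_ne : ∀ a b, G.Adj a b → c a ≠ c b
  edge_ne : ∀ a b b', G.Adj a b → G.Adj a b' → b ≠ b' → g s(a, b) ≠ g s(a, b')
  incident_ne : ∀ a b, G.Adj a b → c a ≠ g s(a, b)
  vertex_notMem : ∀ v, c v ∉ P v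
  edge_notMem : ∀ a b, G.Adj a b → g s(a, b) ∉ P a
  prod_ne : ∀ a b, G.Adj a b → G.spokeProd c g P a ≠ G.spokeProd c g P b

section corona

variable {V W : Type*} [DecidableEq V]

/-- The edge coloring of a corona given by colorings of `G`, of the copies of `H`, and of the edges
in between. -/
def coronaEdgeColoring (gG : Sym2 V → ℕ) (s : V → W → ℕ) (gH : V → Sym2 W → ℕ) :
    Sym2 (V ⊕ V × W) → ℕ :=
  Sym2.lift ⟨fun x y => match x, y with
    | .inl u, .inl v => gG s(u, v)
    | .inl _, .inr p => s p.1 p.2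
    | .inr p, .inl _ => s p.1 p.2
    | .inr p, .inr q => if p.1 = q.1 then gH p.1 s(p.2, q.2) else 0, by
      rintro (u | p) (v | q)
      · simp [Sym2.eq_swap]
      · rfl
      · rfl
      · by_cases h : p.1 = q.1
        · simp [h, Sym2.eq_swap]
        · simp [h, Ne.symm h]⟩

variable (gG : Sym2 V → ℕ) (s : V → W → ℕ) (gH : V → Sym2 W → ℕ)

theorem coronaEdgeColoring_inr_inl (u : V) (p : V × W) :
    coronaEdgeColoring gG s gH s(.inr p, .inl u) = s p.1 p.2 := rfl

theorem coronaEdgeColoring_inr_inr (v : V) (a b : W) :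
    coronaEdgeColoring gG s gH s(.inr (v, a), .inr (v, b)) = gH v s(a, b) := by
  simp [coronaEdgeColoring]

variable [Fintype V] [Fintype W] (G : SimpleGraph V) [DecidableRel G.Adj]
  (H : SimpleGraph W) [DecidableRel H.Adj]

theorem neighborFinset_corona_inl (v : V) :
    (G.corona H).neighborFinset (.inl v) = (G.neighborFinset v).disjSum
      (({v} : Finset V) ×ˢ (Finset.univ : Finset W)) := by
  ext (u | ⟨u, x⟩)
  · rw [mem_neighborFinset, Finset.inl_mem_disjSum, mem_neighborFinset]
    rfl
  · rw [mem_neighborFinset, Finset.inr_mem_disjSum]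
    change v = u ↔ _
    simp [eq_comm]

theorem neighborFinset_corona_inr (v : V) (w : W) :
    (G.corona H).neighborFinset (.inr (v, w)) = ({v} : Finset V).disjSum
      (({v} : Finset V) ×ˢ H.neighborFinset w) := by
  ext (u | ⟨u, x⟩)
  · rw [mem_neighborFinset, Finset.inl_mem_disjSum]
    change v = u ↔ _
    simp [eq_comm]
  · rw [mem_neighborFinset, Finset.inr_mem_disjSum]
    change v = u ∧ H.Adj w x ↔ _
    simp [eq_comm, and_comm]

theorem nbrProd_corona_inl (v : V) :
    (G.corona H).nbrProd (coronaEdgeColoring gG s gH) (.inl v) =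
      G.nbrProd gG v * ∏ w, s v w := by
  rw [nbrProd, neighborFinset_corona_inl, Finset.prod_disjSum, Finset.prod_product,
    Finset.prod_singleton]
  rfl

theorem nbrProd_corona_inr (v : V) (w : W) :
    (G.corona H).nbrProd (coronaEdgeColoring gG s gH) (.inr (v, w)) =
      s v w * H.nbrProd (gH v) w := by
  rw [nbrProd, neighborFinset_corona_inr, Finset.prod_disjSum, Finset.prod_product,
    Finset.prod_singleton, Finset.prod_singleton]
  simp only [coronaEdgeColoring_inr_inl, coronaEdgeColoring_inr_inr]
  rfl

theorem maxDegree_corona_le [Nonempty V] :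
    G.maxDegree + Fintype.card W ≤ (G.corona H).maxDegree := by
  obtain ⟨v, hv⟩ := G.exists_maximal_degree_vertex
  refine le_trans (le_of_eq ?_) ((G.corona H).degree_le_maxDegree (.inl v))
  rw [← card_neighborFinset_eq_degree, neighborFinset_corona_inl, Finset.card_disjSum, hv]
  simp

end corona

/-- Once the sets P are fixed, the products at base vertices no longer depend on how the spoke
colors are distributed. Hence the copies can be colored independently, and every conflict lies
within the base, within one copy, or between a copy and its own base vertex. -/
theorem exists_isNPDTotalColoring_corona {V W : Type*} [Fintype V] [DecidableEq V] [Fintype W]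
    [DecidableEq W] (G : SimpleGraph V) [DecidableRel G.Adj] (H : SimpleGraph W)
    [DecidableRel H.Adj] {k : ℕ} {c : V → ℕ} {g : Sym2 V → ℕ} {P : V → Finset ℕ}
    (hG : G.IsSpokeColoring k c g P)
    (hH : ∀ v, H.HasCopyColoring k (c v) (P v) (G.spokeProd c g P v)) :
    ∃ f g, (G.corona H).IsNPDTotalColoring k f g := by
  choose f s gH hf hinj him hgH hgg hff ht using hH
  have hsP : ∀ v w, s v w ∈ P v := fun v w => by
    rw [← him v]; exact Finset.mem_image_of_mem _ (Finset.mem_univ w)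
  have hprodl : ∀ v, Sum.elim c (fun p : V × W => f p.1 p.2) (.inl v) *
      (G.corona H).nbrProd (coronaEdgeColoring g s gH) (.inl v) = G.spokeProd c g P v := by
    intro v
    rw [nbrProd_corona_inl, spokeProd, ← him v, Finset.prod_image fun a _ b _ h => hinj v h,
      mul_comm (∏ w, s v w)]
    rfl
  have hprodr : ∀ v w, Sum.elim c (fun p : V × W => f p.1 p.2) (.inr (v, w)) *
      (G.corona H).nbrProd (coronaEdgeColoring g s gH) (.inr (v, w)) =
      f v w * (s v w * H.nbrProd (gH v) w) := by
    intro v w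
    rw [nbrProd_corona_inr]
    rfl
  refine ⟨Sum.elim c fun p => f p.1 p.2, coronaEdgeColoring g s gH,
    isNPDTotalColoring_of_adj _ ?_ ?_ ?_ ?_ ?_ ?_⟩
  · rintro (v | ⟨v, w⟩)
    · exact hG.vertex_mem v
    · exact (hf v w).1
  · rintro (v | ⟨v, w⟩) (v' | ⟨v', w'⟩) h
    · exact hG.edge_mem v v' h
    · exact hG.spoke_mem v' (hsP v' w')
    · exact hG.spoke_mem v (hsP v w)
    · obtain ⟨h1 : v = v', h2 : H.Adj w w'⟩ := h
      subst h1
      rw [coronaEdgeColoring_inr_inr]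
      exact (hgH v w w' h2).1
  · rintro (v | ⟨v, w⟩) (v' | ⟨v', w'⟩) h
    · exact hG.vertex_ne v v' h
    · obtain rfl : v = v' := h
      exact (hf v w').2.1.symm
    · obtain rfl : v = v' := h
      exact (hf v w).2.1
    · obtain ⟨h1 : v = v', h2 : H.Adj w w'⟩ := h
      subst h1
      exact (hff v w w' h2).1
  · rintro (v | ⟨v, w⟩) (a | ⟨a, x⟩) (b | ⟨b, y⟩) h h' hne
    · exact hG.edge_ne v a b h h' fun e => hne (by rw [e])
    · obtain rfl : v = b := h'
      refine fun e => hG.edge_notMem v a h ?_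
      have e' : g s(v, a) = s v y := e
      rw [e']; exact hsP v y
    · obtain rfl : v = a := h
      refine fun e => hG.edge_notMem v b h' ?_
      have e' : s v x = g s(v, b) := e
      rw [← e']; exact hsP v x
    · obtain rfl : v = a := h
      obtain rfl : v = b := h'
      exact fun e => hne (by rw [show x = y from hinj v e])
    · obtain rfl : v = a := h
      obtain rfl : v = b := h'
      exact absurd rfl hne
    · obtain rfl : v = a := h
      obtain ⟨h1 : v = b, h2 : H.Adj w y⟩ := h'
      subst h1
      rw [coronaEdgeColoring_inr_inr]
      exact (hgH v w y h2).2.1.symm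
    · obtain rfl : v = b := h'
      obtain ⟨h1 : v = a, h2 : H.Adj w x⟩ := h
      subst h1
      rw [coronaEdgeColoring_inr_inr]
      exact (hgH v w x h2).2.1
    · obtain ⟨h1 : v = a, h2 : H.Adj w x⟩ := h
      obtain ⟨h3 : v = b, h4 : H.Adj w y⟩ := h'
      subst h1 h3
      rw [coronaEdgeColoring_inr_inr, coronaEdgeColoring_inr_inr]
      exact hgg v w x y h2 h4 fun e => hne (by rw [e])
  · rintro (v | ⟨v, w⟩) (v' | ⟨v', w'⟩) h
    · exact hG.incident_ne v v' h
    · obtain rfl : v = v' := h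
      exact fun e => hG.vertex_notMem v (by
        have : c v = s v w' := e
        rw [this]; exact hsP v w')
    · obtain rfl : v = v' := h
      exact (hf v w).2.2
    · obtain ⟨h1 : v = v', h2 : H.Adj w w'⟩ := h
      subst h1
      rw [coronaEdgeColoring_inr_inr]
      exact (hgH v w w' h2).2.2.symm
  · rintro (v | ⟨v, w⟩) (v' | ⟨v', w'⟩) h
    · rw [hprodl, hprodl]
      exact hG.prod_ne v v' h
    · obtain rfl : v = v' := h
      rw [hprodl, hprodr]
      exact (ht v w').symm
    · obtain rfl : v = v' := h
      rw [hprodl, hprodr]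
      exact ht v w
    · obtain ⟨h1 : v = v', h2 : H.Adj w w'⟩ := h
      subst h1
      rw [hprodr, hprodr]
      exact (hff v w w' h2).2

/-! ### Coloring a copy when there are enough colors -/

theorem _root_.Nat.Prime.not_dvd_of_mem_Icc {p k x : ℕ} (hk : k < 2 * p)
    (hx : x ∈ Finset.Icc 1 k) (hxp : x ≠ p) : ¬ p ∣ x := by
  rintro ⟨m, rfl⟩
  rw [Finset.mem_Icc] at hx
  obtain _ | _ | m := m
  · omega
  · exact hxp (by ring)
  · have : p * (m + 1 + 1) = p * m + 2 * p := by ring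
    have := Nat.zero_le (p * m)
    omega

section copy

variable {W : Type*} [Fintype W]

theorem exists_injective_image_eq {P : Finset ℕ} (hP : P.card = Fintype.card W) :
    ∃ s : W → ℕ, Function.Injective s ∧ Finset.univ.image s = P := by
  have e : W ≃ P := Fintype.equivOfCardEq (by simp [hP])
  refine ⟨fun w => e w, fun a b h => e.injective (Subtype.ext h), ?_⟩
  ext x
  simp only [Finset.mem_image, Finset.mem_univ, true_and]
  exact ⟨by rintro ⟨w, rfl⟩; exact (e w).2, fun hx => ⟨e.symm ⟨x, hx⟩, by simp⟩⟩

variable [DecidableEq W]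

theorem exists_injective_image_eq_apply {P : Finset ℕ} (hP : P.card = Fintype.card W) {p : ℕ}
    (hp : p ∈ P) (w : W) :
    ∃ s : W → ℕ, Function.Injective s ∧ Finset.univ.image s = P ∧ s w = p := by
  obtain ⟨s, hs, him⟩ := exists_injective_image_eq hP
  obtain ⟨w', -, hw'⟩ := Finset.mem_image.1 (him ▸ hp)
  refine ⟨s ∘ Equiv.swap w w', hs.comp (Equiv.injective _), ?_, by simpa using hw'⟩
  rw [← Finset.image_image, Finset.image_univ_equiv, him]

variable (H : SimpleGraph W) [DecidableRel H.Adj]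

/-- An edge must avoid 2(D - 1) colors of adjacent edges, the two spoke colors at its ends, the set
X, and one color for each of its at most j ends in Z; `hk` is this count. -/
theorem exists_edge_coloring_avoiding {D k j : ℕ} (hD : ∀ w, H.degree w ≤ D) (s : W → ℕ)
    (X : Finset ℕ) (Z : Finset W) (κ t : W → ℕ) (hκ : ∀ w, 0 < κ w)
    (hZ : ∀ z ∈ Z, ∃ a, H.Adj z a) (hj : ∀ a b, H.Adj a b → (({a, b} : Finset W) ∩ Z).card ≤ j)
    (hk : 2 * (D - 1) + 2 + X.card + j < k) :
    ∃ g : Sym2 W → ℕ, (∀ a b, H.Adj a b → g s(a, b) ∈ Finset.Icc 1 k ∧ g s(a, b) ≠ s a ∧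
        g s(a, b) ∉ X) ∧
      (∀ a b b', H.Adj a b → H.Adj a b' → b ≠ b' → g s(a, b) ≠ g s(a, b')) ∧
      ∀ z ∈ Z, κ z * H.nbrProd g z ≠ t z := by
  obtain ⟨g, h1, h2, h3⟩ := exists_edge_coloring H hD
    (fun e => Finset.Icc 1 k \ (X ∪ e.toFinset.image s)) Z κ t hκ hZ (by simp) (by
      intro a b hab
      have c1 := Finset.le_card_sdiff (X ∪ s(a, b).toFinset.image s) (Finset.Icc 1 k)
      have c2 := Finset.card_union_le X (s(a, b).toFinset.image s)
      have c3 : (s(a, b).toFinset.image s).card ≤ 2 := by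
        refine Finset.card_image_le.trans ?_
        rw [Sym2.toFinset_mk_eq]
        exact Finset.card_le_two
      have := hj a b hab
      rw [Nat.card_Icc] at c1
      omega)
  refine ⟨g, fun a b hab => ?_, h2, h3⟩
  have := h1 s(a, b) hab
  simp only [Finset.mem_sdiff, Finset.mem_union, Finset.mem_image, Sym2.mem_toFinset, not_or,
    not_exists, not_and] at this
  exact ⟨this.1, fun h => this.2.2 a (by simp) h.symm, this.2.1⟩

/-- After a greedy edge coloring, a vertex loses c, its spoke color, the one color giving product t,
and at most D edge colors. This leaves k - (3 + D) ≥ 2D colors, as `exists_list_coloring` needs. -/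
theorem hasCopyColoring_of_le {D k c t : ℕ} {P : Finset ℕ} (hD : ∀ w, H.degree w ≤ D)
    (hP : P ⊆ Finset.Icc 1 k) (hcard : P.card = Fintype.card W) (hk : 3 * D + 3 ≤ k)
    (hk' : 4 ≤ k) : H.HasCopyColoring k c P t := by
  obtain ⟨s, hs, him⟩ := exists_injective_image_eq hcard
  have hsk : ∀ w, s w ∈ Finset.Icc 1 k := fun w =>
    hP (him ▸ Finset.mem_image_of_mem _ (Finset.mem_univ w))
  obtain ⟨g, hg, hgg, -⟩ := exists_edge_coloring_avoiding H (k := k) (j := 0) hD s ∅ ∅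
    (fun _ => 1) (fun _ => 0) (by simp) (by simp) (by simp) (by simp; omega)
  have hκ : ∀ w, 0 < s w * H.nbrProd g w := fun w =>
    Nat.mul_pos (Finset.mem_Icc.1 (hsk w)).1
      (nbrProd_pos H fun a ha => (Finset.mem_Icc.1 (hg w a ha).1).1)
  have hc : ∀ w, k - (3 + D) ≤ (Finset.Icc 1 k \ ({c, s w, t / (s w * H.nbrProd g w)} ∪
      (H.neighborFinset w).image fun a => g s(w, a))).card := by
    intro w
    have c1 := Finset.le_card_sdiff ({c, s w, t / (s w * H.nbrProd g w)} ∪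
      (H.neighborFinset w).image fun a => g s(w, a)) (Finset.Icc 1 k)
    have c2 := Finset.card_union_le ({c, s w, t / (s w * H.nbrProd g w)} : Finset ℕ)
      ((H.neighborFinset w).image fun a => g s(w, a))
    have c3 : ((H.neighborFinset w).image fun a => g s(w, a)).card ≤ D :=
      Finset.card_image_le.trans (by rw [card_neighborFinset_eq_degree]; exact hD w)
    have c4 : ({c, s w, t / (s w * H.nbrProd g w)} : Finset ℕ).card ≤ 3 := Finset.card_le_three
    rw [Nat.card_Icc] at c1
    omega
  obtain ⟨f, hf, hff⟩ := exists_list_coloring H _ _ hκ (by simp)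
    (fun w => Finset.card_pos.1 (lt_of_lt_of_le (by omega) (hc w)))
    (fun w => le_trans (by have := hD w; omega) (hc w))
  simp only [Finset.mem_sdiff, Finset.mem_union, Finset.mem_insert, Finset.mem_singleton, not_or,
    Finset.mem_image, mem_neighborFinset, not_exists, not_and] at hf
  refine ⟨f, s, g, fun w => ⟨(hf w).1, (hf w).2.1.1, (hf w).2.1.2.1⟩, hs, him,
    fun a b hab => ⟨(hg a b hab).1, (hg a b hab).2.1, (hf a).2.2 b hab⟩, hgg, ?_, ?_⟩
  · intro a b hab
    have := hff a b hab
    rwa [mul_comm (f a), mul_comm (f b)]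
  · intro w h
    refine (hf w).2.1.2.2 ?_
    rw [← h, Nat.mul_div_cancel _ (hκ w)]

/-- Isolated vertices are kept out of S because the product at a vertex of S will be steered away
from t by the edges at it. -/
theorem exists_maximal_independent : ∃ S : Finset W, (∀ a ∈ S, ∃ b, H.Adj a b) ∧
    (∀ a ∈ S, ∀ b ∈ S, ¬ H.Adj a b) ∧ ∀ a b, H.Adj a b → a ∉ S → ∃ z ∈ S, H.Adj a z := by
  obtain ⟨S, hS, hmax⟩ := Finset.exists_max_image
    (Finset.univ.filter fun S : Finset W => (∀ a ∈ S, ∃ b, H.Adj a b) ∧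
      ∀ a ∈ S, ∀ b ∈ S, ¬ H.Adj a b) Finset.card ⟨∅, by simp⟩
  simp only [Finset.mem_filter, Finset.mem_univ, true_and] at hS hmax
  refine ⟨S, hS.1, hS.2, fun a b hab ha => ?_⟩
  by_contra! hcon
  have := hmax (insert a S) ⟨?_, ?_⟩
  · rw [Finset.card_insert_of_notMem ha] at this
    omega
  · intro x hx
    rcases Finset.mem_insert.1 hx with rfl | hx
    · exact ⟨b, hab⟩
    · exact hS.1 x hx
  · intro x hx y hy hxy
    by_cases hxa : x = a
    · subst hxa
      exact hcon y ((Finset.mem_insert.1 hy).resolve_left hxy.ne') hxy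
    · have hxS := (Finset.mem_insert.1 hx).resolve_left hxa
      by_cases hya : y = a
      · subst hya
        exact hcon x hxS hxy.symm
      · exact hS.2 x hxS y ((Finset.mem_insert.1 hy).resolve_left hya) hxy

/-- As k < 2p, the only multiple of p among the colors is p. Give color p to a maximal independent
set S, the spoke color p to one vertex u outside S, and p to no edge. Then p divides t and the
products in S and at u, but no other product in the copy. The only conflicts left are those of t
with S or u, of u with S, and among the other vertices. The last induce degree at most D - 1, which
explains 3D + 1 in place of 3D + 3. -/
theorem hasCopyColoring_of_prime {D k c t p : ℕ} {P : Finset ℕ} (hD : ∀ w, H.degree w ≤ D)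
    (hP : P ⊆ Finset.Icc 1 k) (hcard : P.card = Fintype.card W) (hp : p.Prime) (hpP : p ∈ P)
    (hcp : c ≠ p) (hkp : k < 2 * p) (hpt : p ∣ t) (hH : ∃ a b, H.Adj a b) (hk : 3 * D + 1 ≤ k)
    (hk' : 2 * D + 4 ≤ k) : H.HasCopyColoring k c P t := by
  obtain ⟨S, hS1, hS2, hS3⟩ := H.exists_maximal_independent
  obtain ⟨u, hu⟩ : ∃ u, u ∉ S := by
    obtain ⟨a, b, hab⟩ := hH
    by_contra! h
    exact hS2 a (h a) b (h b) hab
  have hDpos : 0 < D := by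
    obtain ⟨a, b, hab⟩ := hH
    exact lt_of_lt_of_le ((H.degree_pos_iff_exists_adj a).2 ⟨b, hab⟩) (hD a)
  obtain ⟨s, hs, him, hsu⟩ := exists_injective_image_eq_apply hcard hpP u
  have hsk : ∀ w, s w ∈ Finset.Icc 1 k := fun w =>
    hP (him ▸ Finset.mem_image_of_mem _ (Finset.mem_univ w))
  -- Vertices of S have the fixed color p, so the edges must make their products differ from t. As S
  -- is independent, each edge carries at most one such condition.
  obtain ⟨g, hg, hgg, hgS⟩ := exists_edge_coloring_avoiding H (k := k) (j := 1) hD s {p} S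
    (fun w => p * s w) (fun _ => t)
    (fun w => Nat.mul_pos hp.pos (Finset.mem_Icc.1 (hsk w)).1) hS1
    (by
      intro a b hab
      rw [Finset.card_le_one]
      intro x hx y hy
      simp only [Finset.mem_inter, Finset.mem_insert, Finset.mem_singleton] at hx hy
      obtain ⟨rfl | rfl, hx⟩ := hx <;> obtain ⟨rfl | rfl, hy⟩ := hy
      · rfl
      · exact absurd hab (hS2 _ hx _ hy)
      · exact absurd hab (hS2 _ hy _ hx)
      · rfl)
    (by simp; omega)
  simp only [Finset.mem_singleton] at hg
  set κ : W → ℕ := fun w => s w * H.nbrProd g w with hκdef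
  have hκ : ∀ w, 0 < κ w := fun w =>
    Nat.mul_pos (Finset.mem_Icc.1 (hsk w)).1
      (nbrProd_pos H fun a ha => (Finset.mem_Icc.1 (hg w a ha).1).1)
  have hdvd : ∀ w, w ≠ u → ¬ p ∣ κ w := by
    intro w hw h
    rcases hp.dvd_mul.1 h with h | h
    · exact Nat.Prime.not_dvd_of_mem_Icc hkp (hsk w) (fun h => hw (hs (h.trans hsu.symm))) h
    · obtain ⟨a, ha, h⟩ := (hp.prime.dvd_finsetProd_iff _).1 h
      have ha' : H.Adj w a := by simpa using ha
      exact Nat.Prime.not_dvd_of_mem_Icc hkp (hg w a ha').1 (hg w a ha').2.2 h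
  -- K keeps the edges between vertices outside S and other than u. By maximality, a vertex with an
  -- edge in K also has a neighbor in S and so loses degree.
  let K : SimpleGraph W :=
    { Adj := fun a b => H.Adj a b ∧ (a ∉ S ∧ a ≠ u) ∧ (b ∉ S ∧ b ≠ u)
      symm := ⟨fun a b h => ⟨h.1.symm, h.2.2, h.2.1⟩⟩
      loopless := ⟨fun a h => H.irrefl h.1⟩ }
  have : DecidableRel K.Adj := fun a b =>
    inferInstanceAs (Decidable (H.Adj a b ∧ (a ∉ S ∧ a ≠ u) ∧ (b ∉ S ∧ b ≠ u)))
  have hKdeg : ∀ w, K.degree w ≤ D - 1 := by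
    intro w
    by_cases hw : ∃ a, K.Adj w a
    · obtain ⟨a, ha, hwS, -⟩ := hw
      obtain ⟨z, hz, hwz⟩ := hS3 w a ha hwS.1
      have hsub : K.neighborFinset w ⊆ (H.neighborFinset w).erase z := by
        intro x hx
        have hx' : K.Adj w x := by simpa using hx
        rw [Finset.mem_erase, mem_neighborFinset]
        exact ⟨fun h => hx'.2.2.1 (h ▸ hz), hx'.1⟩
      have h1 := Finset.card_le_card hsub
      rw [Finset.card_erase_of_mem (by simpa using hwz), card_neighborFinset_eq_degree,
        card_neighborFinset_eq_degree] at h1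
      have := hD w
      omega
    · have : K.degree w = 0 := by
        by_contra h
        exact hw ((K.degree_pos_iff_exists_adj w).1 (Nat.pos_of_ne_zero h))
      omega
  have hgc : ∀ w, ((H.neighborFinset w).image fun a => g s(w, a)).card ≤ D := fun w =>
    Finset.card_image_le.trans (by rw [card_neighborFinset_eq_degree]; exact hD w)
  have hc : ∀ w, k - (3 + D) ≤ (Finset.Icc 1 k \ ({c, s w, p} ∪
      (H.neighborFinset w).image fun a => g s(w, a))).card := by
    intro w
    have c1 := Finset.le_card_sdiff ({c, s w, p} ∪
      (H.neighborFinset w).image fun a => g s(w, a)) (Finset.Icc 1 k)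
    have c2 := Finset.card_union_le ({c, s w, p} : Finset ℕ)
      ((H.neighborFinset w).image fun a => g s(w, a))
    have c3 := hgc w
    have c4 : ({c, s w, p} : Finset ℕ).card ≤ 3 := Finset.card_le_three
    rw [Nat.card_Icc] at c1
    omega
  obtain ⟨f, hf, hff⟩ := exists_list_coloring K _ κ hκ (by simp)
    (fun w => Finset.card_pos.1 (lt_of_lt_of_le (by omega) (hc w)))
    (fun w => le_trans (by have := hKdeg w; omega) (hc w))
  simp only [Finset.mem_sdiff, Finset.mem_union, Finset.mem_insert, Finset.mem_singleton, not_or,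
    Finset.mem_image, mem_neighborFinset, not_exists, not_and] at hf
  -- The vertex u is colored last. Each neighbor forbids one value only: in S just the equal product
  -- matters, since p is already excluded; outside S just the color, since divisibility by p
  -- separates the products. In all at most 3 + 2D values are excluded, whence 2D + 4 ≤ k.
  obtain ⟨x, hx⟩ : (Finset.Icc 1 k \ ({c, p, t / κ u} ∪
      ((H.neighborFinset u).image (fun a => g s(u, a)) ∪
      (H.neighborFinset u).image fun a => if a ∈ S then p * κ a / κ u else f a))).Nonempty := by
    rw [← Finset.card_pos]
    have c1 := Finset.le_card_sdiff ({c, p, t / κ u} ∪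
      ((H.neighborFinset u).image (fun a => g s(u, a)) ∪
      (H.neighborFinset u).image fun a => if a ∈ S then p * κ a / κ u else f a)) (Finset.Icc 1 k)
    have c2 := Finset.card_union_le ({c, p, t / κ u} : Finset ℕ)
      ((H.neighborFinset u).image (fun a => g s(u, a)) ∪
      (H.neighborFinset u).image fun a => if a ∈ S then p * κ a / κ u else f a)
    have c3 := Finset.card_union_le ((H.neighborFinset u).image (fun a => g s(u, a)))
      ((H.neighborFinset u).image fun a => if a ∈ S then p * κ a / κ u else f a)
    have c4 := hgc u
    have c5 : ((H.neighborFinset u).image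
        fun a => if a ∈ S then p * κ a / κ u else f a).card ≤ D :=
      Finset.card_image_le.trans (by rw [card_neighborFinset_eq_degree]; exact hD u)
    have c6 : ({c, p, t / κ u} : Finset ℕ).card ≤ 3 := Finset.card_le_three
    rw [Nat.card_Icc] at c1
    omega
  simp only [Finset.mem_sdiff, Finset.mem_union, Finset.mem_insert, Finset.mem_singleton, not_or,
    Finset.mem_image, mem_neighborFinset, not_exists, not_and] at hx
  obtain ⟨hxk, ⟨hxc, hxp, hxt⟩, hxg, hxf⟩ := hx
  let F : W → ℕ := fun w => if w ∈ S then p else if w = u then x else f w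
  have FS : ∀ w ∈ S, F w = p := fun w hw => by simp [F, hw]
  have Fu : F u = x := by simp [F, hu]
  have Fo : ∀ w, w ∉ S → w ≠ u → F w = f w := fun w h1 h2 => by simp [F, h1, h2]
  have hFdvd : ∀ w, w ∉ S → w ≠ u → ¬ p ∣ F w * κ w := by
    intro w h1 h2 h
    rw [Fo w h1 h2] at h
    rcases hp.dvd_mul.1 h with h | h
    · exact Nat.Prime.not_dvd_of_mem_Icc hkp (hf w).1 (hf w).2.1.2.2 h
    · exact hdvd w h2 h
  have hudvd : p ∣ F u * κ u := Dvd.dvd.mul_left (Dvd.dvd.mul_right (by rw [hsu]) _) _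
  have keyS : ∀ a b, H.Adj a b → a ∈ S → F a ≠ F b ∧ F a * κ a ≠ F b * κ b := by
    intro a b hab ha
    have hb : b ∉ S := fun hb => hS2 a ha b hb hab
    by_cases hbu : b = u
    · subst hbu
      rw [FS a ha, Fu]
      refine ⟨Ne.symm hxp, fun h => hxf a hab.symm ?_⟩
      rw [if_pos ha, h, Nat.mul_div_cancel _ (hκ b)]
    · refine ⟨?_, fun h => hFdvd b hb hbu ?_⟩
      · rw [FS a ha, Fo b hb hbu]
        exact Ne.symm (hf b).2.1.2.2
      · rw [← h, FS a ha]
        exact Dvd.intro _ rfl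
  have keyu : ∀ b, H.Adj u b → b ∉ S → F u ≠ F b ∧ F u * κ u ≠ F b * κ b := by
    intro b hub hb
    have hbu : b ≠ u := hub.ne'
    refine ⟨?_, fun h => hFdvd b hb hbu (h ▸ hudvd)⟩
    rw [Fu, Fo b hb hbu]
    have := hxf b hub
    rw [if_neg hb] at this
    exact Ne.symm this
  refine ⟨F, s, g, ?_, hs, him, ?_, hgg, ?_, ?_⟩
  · intro w
    by_cases hw : w ∈ S
    · rw [FS w hw]
      exact ⟨hP hpP, hcp.symm, fun h => hu (hs (hsu.trans h) ▸ hw)⟩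
    · by_cases hwu : w = u
      · subst hwu
        rw [Fu]
        exact ⟨hxk, hxc, hsu.symm ▸ hxp⟩
      · rw [Fo w hw hwu]
        exact ⟨(hf w).1, (hf w).2.1.1, (hf w).2.1.2.1⟩
  · intro a b hab
    refine ⟨(hg a b hab).1, (hg a b hab).2.1, ?_⟩
    by_cases ha : a ∈ S
    · rw [FS a ha]; exact (hg a b hab).2.2
    · by_cases hau : a = u
      · subst hau
        rw [Fu]; exact hxg b hab
      · rw [Fo a ha hau]; exact (hf a).2.2 b hab
  · intro a b hab
    by_cases ha : a ∈ S
    · exact keyS a b hab ha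
    by_cases hb : b ∈ S
    · exact (keyS b a hab.symm hb).imp Ne.symm Ne.symm
    by_cases hau : a = u
    · subst hau; exact keyu b hab hb
    by_cases hbu : b = u
    · subst hbu; exact (keyu a hab.symm ha).imp Ne.symm Ne.symm
    have := hff a b ⟨hab, ⟨ha, hau⟩, hb, hbu⟩
    rwa [Fo a ha hau, Fo b hb hbu, mul_comm (f a), mul_comm (f b)]
  · intro w
    change F w * κ w ≠ t
    by_cases hw : w ∈ S
    · rw [FS w hw, hκdef, ← mul_assoc]
      exact hgS w hw
    · by_cases hwu : w = u
      · subst hwu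
        rw [Fu]
        intro h
        exact hxt (by rw [← h, Nat.mul_div_cancel _ (hκ w)])
      · exact fun h => hFdvd w hw hwu (h ▸ hpt)

end copy

/-! ### Universal colorings for small copies -/

/-- The products of at most `r` entries of a list. -/
def listProds : ℕ → List ℕ → List ℕ
  | _, [] => [1]
  | 0, _ :: _ => [1]
  | r + 1, x :: l => listProds (r + 1) l ++ (listProds r l).map (x * ·)

theorem prod_mem_listProds {α : Type*} [DecidableEq α] (h : α → ℕ) (l : List α) (A : Finset α)
    (r : ℕ) (hA : ∀ a ∈ A, a ∈ l) (hr : A.card ≤ r) :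
    ∏ a ∈ A, h a ∈ listProds r (l.map h) := by
  induction l generalizing A r with
  | nil =>
    have : A = ∅ := Finset.eq_empty_of_forall_notMem fun a ha => by simpa using hA a ha
    cases r <;> simp [this, listProds]
  | cons x l ih =>
    obtain _ | r := r
    · have : A = ∅ := Finset.card_eq_zero.1 (by omega)
      simp [this, listProds]
    · simp only [List.map_cons, listProds, List.mem_append, List.mem_map]
      by_cases hx : x ∈ A
      · right
        refine ⟨∏ a ∈ A.erase x, h a, ih _ _ ?_ ?_, Finset.mul_prod_erase A h hx⟩
        · intro a ha
          have ha' := Finset.mem_erase.1 ha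
          exact (List.mem_cons.1 (hA a ha'.2)).resolve_left ha'.1
        · rw [Finset.card_erase_of_mem hx]; omega
      · left
        refine ih _ _ (fun a ha => (List.mem_cons.1 (hA a ha)).resolve_left ?_) hr
        rintro rfl; exact hx ha

/-- The entry of a matrix of natural numbers given by its list of rows. -/
def listEntry (M : List (List ℕ)) (i j : ℕ) : ℕ := (M.getD i []).getD j 0

/-- A total coloring of the complete graph on `n` vertices joined to one more vertex of color `c`
and with product `t`, whose restriction to every subgraph of maximum degree at most three of the
complete graph on the `n` vertices has different products at adjacent vertices. The lists `f` and
`s` contain the colors of the vertices and of the edges to the additional vertex, and the matrix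
`e` the colors of the other edges. -/
def IsUniversalColoring (n k c t : ℕ) (f s : List ℕ) (e : List (List ℕ)) : Prop :=
  (∀ i < n, 1 ≤ f.getD i 0 ∧ f.getD i 0 ≤ k ∧ f.getD i 0 ≠ c ∧ f.getD i 0 ≠ s.getD i 0 ∧
    ∀ x ∈ listProds 3 (((List.range n).filter (· ≠ i)).map (listEntry e i)),
      f.getD i 0 * (s.getD i 0 * x) ≠ t) ∧
  ∀ i < n, ∀ j < n, i ≠ j → s.getD i 0 ≠ s.getD j 0 ∧ f.getD i 0 ≠ f.getD j 0 ∧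
    listEntry e i j = listEntry e j i ∧ 1 ≤ listEntry e i j ∧ listEntry e i j ≤ k ∧
    listEntry e i j ≠ s.getD i 0 ∧ listEntry e i j ≠ f.getD i 0 ∧
    (∀ l < n, l ≠ i → j ≠ l → listEntry e i j ≠ listEntry e i l) ∧
    ∀ x ∈ listProds 2 (((List.range n).filter (fun l => l ≠ i ∧ l ≠ j)).map (listEntry e i)),
      ∀ y ∈ listProds 2 (((List.range n).filter (fun l => l ≠ j ∧ l ≠ i)).map (listEntry e j)),
        f.getD i 0 * (s.getD i 0 * x) ≠ f.getD j 0 * (s.getD j 0 * y)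

set_option synthInstance.maxSize 2000 in
set_option synthInstance.maxHeartbeats 200000 in
instance (n k c t : ℕ) (f s : List ℕ) (e : List (List ℕ)) :
    Decidable (IsUniversalColoring n k c t f s e) := by
  unfold IsUniversalColoring; infer_instance

/-- Any enumeration of the vertices embeds H in the complete graph. Properness is inherited, and as
H is subcubic its products are among the finitely many ones tested. -/
theorem hasCopyColoring_of_universal {W : Type*} [Fintype W] [DecidableEq W]
    (H : SimpleGraph W) [DecidableRel H.Adj] (hD : ∀ w, H.degree w ≤ 3) {n k c t : ℕ}
    (hn : Fintype.card W = n) {f s : List ℕ} {e : List (List ℕ)}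
    (hu : IsUniversalColoring n k c t f s e) (hsn : s.length = n) :
    H.HasCopyColoring k c s.toFinset t := by
  obtain ⟨h1, h2⟩ := hu
  obtain ⟨φ⟩ : Nonempty (W ≃ Fin n) := ⟨Fintype.equivFinOfCardEq hn⟩
  have hφ : ∀ a b : W, a ≠ b → (φ a : ℕ) ≠ φ b := fun a b hab h =>
    hab (φ.injective (Fin.ext h))
  let g : Sym2 W → ℕ := Sym2.lift ⟨fun a b => listEntry e (φ a) (φ b), fun a b => by
    by_cases hab : a = b
    · rw [hab]
    · exact (h2 _ (φ a).2 _ (φ b).2 (hφ a b hab)).2.2.1⟩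
  have hg : ∀ a b, g s(a, b) = listEntry e (φ a) (φ b) := fun a b => rfl
  have hprod : ∀ (a : W) (A : Finset W) (p : ℕ → Prop) [DecidablePred p] (r : ℕ),
      A.card ≤ r → (∀ x ∈ A, p (φ x)) →
      ∏ x ∈ A, g s(a, x) ∈ listProds r (((List.range n).filter p).map (listEntry e (φ a))) := by
    intro a A p _ r hr hp
    have hinj : Set.InjOn (fun x => (φ x : ℕ)) (A : Set W) := fun x _ y _ h =>
      φ.injective (Fin.ext h)
    have := prod_mem_listProds (listEntry e (φ a)) ((List.range n).filter p)
      (A.image fun x => (φ x : ℕ)) r (by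
        intro i hi
        obtain ⟨x, hx, rfl⟩ := Finset.mem_image.1 hi
        simpa using hp x hx) (Finset.card_image_le.trans hr)
    rwa [Finset.prod_image hinj] at this
  refine ⟨fun w => f.getD (φ w) 0, fun w => s.getD (φ w) 0, g, ?_, ?_, ?_, ?_, ?_, ?_, ?_⟩
  · intro w
    obtain ⟨h3, h4, h5, h6, -⟩ := h1 _ (φ w).2
    exact ⟨Finset.mem_Icc.2 ⟨h3, h4⟩, h5, h6⟩
  · intro a b hab
    by_contra hne
    exact (h2 _ (φ a).2 _ (φ b).2 (hφ a b hne)).1 hab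
  · ext x
    simp only [Finset.mem_image, Finset.mem_univ, true_and, List.mem_toFinset]
    constructor
    · rintro ⟨w, rfl⟩
      have hw : (φ w : ℕ) < s.length := hsn ▸ (φ w).2
      rw [List.getD_eq_getElem _ _ hw]
      exact List.getElem_mem _
    · intro hx
      obtain ⟨i, hi, rfl⟩ := List.getElem_of_mem hx
      refine ⟨φ.symm ⟨i, hsn ▸ hi⟩, ?_⟩
      simp [hi]
  · intro a b hab
    obtain ⟨-, -, -, h3, h4, h5, h6, -⟩ := h2 _ (φ a).2 _ (φ b).2 (hφ a b hab.ne)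
    exact ⟨Finset.mem_Icc.2 ⟨h3, h4⟩, h5, h6⟩
  · intro a b b' hb hb' hne
    obtain ⟨-, -, -, -, -, -, -, h3, -⟩ := h2 _ (φ a).2 _ (φ b).2 (hφ a b hb.ne)
    exact h3 _ (φ b').2 (hφ b' a hb'.ne') (hφ b b' hne)
  · intro a b hab
    obtain ⟨-, h3, h4, h5, -, -, -, -, h6⟩ := h2 _ (φ a).2 _ (φ b).2 (hφ a b hab.ne)
    refine ⟨h3, ?_⟩
    have key : ∀ a b, H.Adj a b → H.nbrProd g a = listEntry e (φ a) (φ b) *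
          ∏ x ∈ (H.neighborFinset a).erase b, g s(a, x) ∧
        ∏ x ∈ (H.neighborFinset a).erase b, g s(a, x) ∈ listProds 2
          (((List.range n).filter (fun l : ℕ => l ≠ φ a ∧ l ≠ φ b)).map (listEntry e (φ a))) := by
      intro a b hab
      have hb : b ∈ H.neighborFinset a := by simpa using hab
      refine ⟨(Finset.mul_prod_erase _ _ hb).symm, hprod _ _ (fun l : ℕ => l ≠ φ a ∧ l ≠ φ b) _ ?_ ?_⟩
      · rw [Finset.card_erase_of_mem hb, card_neighborFinset_eq_degree]
        have := hD a
        omega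
      · intro x hx
        obtain ⟨hxb, hx⟩ := Finset.mem_erase.1 hx
        have hx' : H.Adj a x := by simpa using hx
        exact ⟨hφ x a hx'.ne', hφ x b hxb⟩
    obtain ⟨ha1, ha2⟩ := key a b hab
    obtain ⟨hb1, hb2⟩ := key b a hab.symm
    -- The color of the common edge is a factor of both products and cancels. At most two other
    -- neighbors remain on each side, which is why `listProds 2` suffices.
    rw [ha1, hb1, ← h4]
    intro h
    refine h6 _ ha2 _ hb2 (Nat.eq_of_mul_eq_mul_left (show 0 < listEntry e (φ a) (φ b) from h5) ?_)
    linarith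
  · intro w
    obtain ⟨-, -, -, -, h3⟩ := h1 _ (φ w).2
    refine h3 _ (hprod _ _ (fun l : ℕ => l ≠ φ w) _ ?_ ?_)
    · rw [card_neighborFinset_eq_degree]
      exact hD w
    · intro x hx
      have hx' : H.Adj w x := by simpa using hx
      exact hφ x w hx'.ne'

theorem isUniversalColoring_two_five : IsUniversalColoring 2 5 1 20 [3, 2] [4, 5]
    [[0, 1], [1, 0]] := by
  decide +kernel

theorem isUniversalColoring_three_six : IsUniversalColoring 3 6 6 360 [5, 3, 2] [3, 4, 5]
    [[0, 1, 4], [1, 0, 6], [4, 6, 0]] := by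
  decide +kernel

theorem isUniversalColoring_four_seven : IsUniversalColoring 4 7 5 720 [7, 6, 2, 4] [2, 3, 4, 6]
    [[0, 1, 5, 3], [1, 0, 7, 5], [5, 7, 0, 1], [3, 5, 1, 0]] := by
  decide +kernel

theorem isUniversalColoring_five_eight : IsUniversalColoring 5 8 6 2880 [7, 8, 5, 2, 1] [1, 3, 4, 5, 8]
    [[0, 6, 2, 3, 4], [6, 0, 7, 1, 2], [2, 7, 0, 8, 6], [3, 1, 8, 0, 7], [4, 2, 6, 7, 0]] := by
  decide +kernel

theorem isUniversalColoring_six_nine : IsUniversalColoring 6 9 4 20160 [5, 1, 9, 2, 7, 8] [1, 2, 5, 7, 8, 9]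
    [[0, 8, 4, 3, 2, 6], [8, 0, 3, 9, 6, 4], [4, 3, 0, 6, 1, 7], [3, 9, 6, 0, 5, 1], [2, 6, 1, 5, 0, 3], [6, 4, 7, 1, 3, 0]] := by
  decide +kernel

theorem isUniversalColoring_three_seven_left : IsUniversalColoring 3 7 2 168 [1, 5, 3] [3, 4, 7]
    [[0, 2, 5], [2, 0, 6], [5, 6, 0]] := by
  decide +kernel

theorem isUniversalColoring_three_seven_right : IsUniversalColoring 3 7 6 840 [7, 4, 1] [4, 5, 7]
    [[0, 1, 2], [1, 0, 3], [2, 3, 0]] := by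
  decide +kernel

theorem isUniversalColoring_four_eight_left : IsUniversalColoring 4 8 5 960 [3, 6, 1, 7] [2, 3, 4, 8]
    [[0, 7, 5, 1], [7, 0, 8, 4], [5, 8, 0, 2], [1, 4, 2, 0]] := by
  decide +kernel

theorem isUniversalColoring_four_eight_right : IsUniversalColoring 4 8 7 3360 [6, 3, 4, 1] [3, 4, 5, 8]
    [[0, 8, 7, 5], [8, 0, 1, 6], [7, 1, 0, 2], [5, 6, 2, 0]] := by
  decide +kernel

theorem isUniversalColoring_five_nine_left : IsUniversalColoring 5 9 9 12960 [5, 4, 3, 7, 2] [2, 3, 5, 6, 8]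
    [[0, 1, 6, 4, 7], [1, 0, 2, 8, 6], [6, 2, 0, 9, 4], [4, 8, 9, 0, 5], [7, 6, 4, 5, 0]] := by
  decide +kernel

theorem isUniversalColoring_five_nine_right : IsUniversalColoring 5 9 6 22680 [7, 5, 8, 2, 3] [3, 4, 5, 7, 9]
    [[0, 1, 4, 6, 5], [1, 0, 7, 9, 6], [4, 7, 0, 1, 2], [6, 9, 1, 0, 4], [5, 6, 2, 4, 0]] := by
  decide +kernel

theorem isUniversalColoring_four_nine : ∀ c ∈ [5, 7, 6], ∀ a ∈ [1, 3, 8],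
    ∀ x ∈ listProds 3 [1, 3, 8], IsUniversalColoring 4 9 c (c * (72 * x)) [8, 2, 1, 4] [2, 4, 9, a]
      [[0, 1, 6, 5], [1, 0, 3, 9], [6, 3, 0, 7], [5, 9, 7, 0]] := by
  decide +kernel

/-! ### Spoke colorings of the base graph -/

theorem exists_subset_prod_notMem {A Y : Finset ℕ} {j : ℕ} (h0 : 0 ∉ A)
    (h : j = 1 ∧ Y.card < A.card ∨ 2 ≤ j ∧ j + 2 ≤ A.card ∧ Y.card ≤ 3) :
    ∃ B ⊆ A, B.card = j ∧ ∏ x ∈ B, x ∉ Y := by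
  rcases h with ⟨rfl, h⟩ | ⟨h2, hA, hY⟩
  · obtain ⟨x, hx, hxY⟩ := Finset.exists_mem_notMem_of_card_lt_card h
    exact ⟨{x}, by simpa using hx, by simp, by simpa using hxY⟩
  · obtain ⟨B, hBA, hB⟩ := Finset.exists_subset_card_eq (show 4 ≤ A.card by omega)
    obtain ⟨C, hCA, hC⟩ := Finset.exists_subset_card_eq (show j - 2 ≤ (A \ B).card by
      rw [Finset.card_sdiff_of_subset hBA]; omega)
    have hdisj : ∀ x ∈ B, x ∉ C := fun x hx hx' => (Finset.mem_sdiff.1 (hCA hx')).2 hx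
    let f := B.orderEmbOfFin hB
    have hf : ∀ i, f i ∈ B := fun i => B.orderEmbOfFin_mem hB i
    have hlt : ∀ i j, i < j → f i < f j := fun i j h => f.strictMono h
    have hpos : ∀ i, 0 < f i := fun i => Nat.pos_of_ne_zero fun h => h0 (h ▸ hBA (hf i))
    have hCpos : 0 < ∏ x ∈ C, x := Finset.prod_pos fun x hx =>
      Nat.pos_of_ne_zero fun h => h0 (h ▸ (Finset.mem_sdiff.1 (hCA hx)).1)
    have key : ∀ i l, i < l → f i * (f l * ∏ x ∈ C, x) ∉ Y →
        ∃ B ⊆ A, B.card = j ∧ ∏ x ∈ B, x ∉ Y := by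
      intro i l hil hY
      have hl : f l ∉ C := hdisj _ (hf l)
      have hi : f i ∉ insert (f l) C := by
        simp [(hlt i l hil).ne, hdisj _ (hf i)]
      refine ⟨insert (f i) (insert (f l) C), ?_, ?_, ?_⟩
      · intro x hx
        rcases Finset.mem_insert.1 hx with rfl | hx
        · exact hBA (hf i)
        rcases Finset.mem_insert.1 hx with rfl | hx
        · exact hBA (hf l)
        · exact (Finset.mem_sdiff.1 (hCA hx)).1
      · rw [Finset.card_insert_of_notMem hi, Finset.card_insert_of_notMem hl, hC]
        omega
      · rwa [Finset.prod_insert hi, Finset.prod_insert hl]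
    by_contra hcon
    have h1 := fun i j hij => by_contra fun h => hcon (key i j hij h)
    -- With j - 2 elements fixed in C, the pairs 01, 02, 03, 13 from four increasing numbers give
    -- strictly increasing products. Four candidates cannot all lie in Y, which has at most three
    -- elements.
    have e1 : f 0 * (f 1 * ∏ x ∈ C, x) < f 0 * (f 2 * ∏ x ∈ C, x) :=
      Nat.mul_lt_mul_of_pos_left (Nat.mul_lt_mul_of_pos_right (hlt 1 2 (by decide)) hCpos) (hpos 0)
    have e2 : f 0 * (f 2 * ∏ x ∈ C, x) < f 0 * (f 3 * ∏ x ∈ C, x) :=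
      Nat.mul_lt_mul_of_pos_left (Nat.mul_lt_mul_of_pos_right (hlt 2 3 (by decide)) hCpos) (hpos 0)
    have e3 : f 0 * (f 3 * ∏ x ∈ C, x) < f 1 * (f 3 * ∏ x ∈ C, x) :=
      Nat.mul_lt_mul_of_pos_right (hlt 0 1 (by decide)) (Nat.mul_pos (hpos 3) hCpos)
    have hsub : ({f 0 * (f 1 * ∏ x ∈ C, x), f 0 * (f 2 * ∏ x ∈ C, x), f 0 * (f 3 * ∏ x ∈ C, x),
        f 1 * (f 3 * ∏ x ∈ C, x)} : Finset ℕ) ⊆ Y := by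
      intro x hx
      simp only [Finset.mem_insert, Finset.mem_singleton] at hx
      rcases hx with rfl | rfl | rfl | rfl
      · exact h1 0 1 (by decide)
      · exact h1 0 2 (by decide)
      · exact h1 0 3 (by decide)
      · exact h1 1 3 (by decide)
    have hcard := Finset.card_le_card hsub
    rw [Finset.card_insert_of_notMem, Finset.card_insert_of_notMem,
      Finset.card_insert_of_notMem, Finset.card_singleton] at hcard
    · omega
    · simp only [Finset.mem_singleton]; exact e3.ne
    · simp only [Finset.mem_insert, Finset.mem_singleton, not_or]
      exact ⟨e2.ne, (e2.trans e3).ne⟩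
    · simp only [Finset.mem_insert, Finset.mem_singleton, not_or]
      exact ⟨e1.ne, (e1.trans e2).ne, (e1.trans (e2.trans e3)).ne⟩

section spokes

variable {V : Type*} [Fintype V] (G : SimpleGraph V) [DecidableRel G.Adj]

theorem card_image_neighborFinset_le {D : ℕ} (hD : ∀ v, G.degree v ≤ D) (v : V) (h : V → ℕ) :
    ((G.neighborFinset v).image h).card ≤ D :=
  Finset.card_image_le.trans (by rw [card_neighborFinset_eq_degree]; exact hD v)

/-- Spoke colorings of graphs without edges. -/
theorem isSpokeColoring_const {k c : ℕ} {P : Finset ℕ} (hG : ∀ v, G.degree v ≤ 0)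
    (hc : c ∈ Finset.Icc 1 k) (hP : P ⊆ Finset.Icc 1 k) (hcP : c ∉ P) :
    G.IsSpokeColoring k (fun _ => c) (fun _ => 1) (fun _ => P) := by
  have hG' : ∀ a b, ¬ G.Adj a b := fun a b hab =>
    absurd ((G.degree_pos_iff_exists_adj a).2 ⟨b, hab⟩) (by have := hG a; omega)
  exact ⟨fun _ => hc, fun a b h => absurd h (hG' a b), fun _ => hP,
    fun a b h => absurd h (hG' a b), fun a b _ h => absurd h (hG' a b),
    fun a b h => absurd h (hG' a b), fun _ => hcP, fun a b h => absurd h (hG' a b),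
    fun a b h => absurd h (hG' a b)⟩

theorem spokeProd_one (c : V → ℕ) (P : V → Finset ℕ) (v : V) :
    G.spokeProd c (fun _ => 1) P v = c v * ∏ x ∈ P v, x := by
  simp [spokeProd, nbrProd]

/-- Spoke colorings of graphs of maximum degree one using the color `1` for the edges. -/
theorem exists_isSpokeColoring_cond {k c₁ c₂ : ℕ} {P₁ P₂ : Finset ℕ} (hG : ∀ v, G.degree v ≤ 1)
    (hc₁ : c₁ ∈ Finset.Icc 2 k) (hc₂ : c₂ ∈ Finset.Icc 2 k) (hP₁ : P₁ ⊆ Finset.Icc 2 k)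
    (hP₂ : P₂ ⊆ Finset.Icc 2 k) (hcP₁ : c₁ ∉ P₁) (hcP₂ : c₂ ∉ P₂) (hc : c₁ ≠ c₂)
    (hprod : c₁ * ∏ x ∈ P₁, x ≠ c₂ * ∏ x ∈ P₂, x) :
    ∃ γ : V → Bool, G.IsSpokeColoring k (fun v => cond (γ v) c₁ c₂) (fun _ => 1)
      (fun v => cond (γ v) P₁ P₂) := by
  have hsub : Finset.Icc 2 k ⊆ Finset.Icc 1 k := Finset.Icc_subset_Icc_left (by omega)
  have uniq : ∀ a b b', G.Adj a b → G.Adj a b' → b = b' := by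
    intro a b b' h h'
    have h1 := hG a
    rw [← card_neighborFinset_eq_degree, Finset.card_le_one] at h1
    exact h1 b (by simpa using h) b' (by simpa using h')
  obtain ⟨γ, -, hγ⟩ := exists_assignment_of_extension G (fun _ (_ : Bool) => True)
    (fun _ x _ y => x ≠ y) (fun _ _ _ _ h => h.symm) (by
      intro φ u
      by_cases h : ∃ w, G.Adj u w
      · obtain ⟨w, hw⟩ := h
        refine ⟨!(φ w), trivial, fun w' hw' => ?_⟩
        rw [uniq u w' w hw' hw]
        simp
      · exact ⟨true, trivial, fun w hw => absurd ⟨w, hw⟩ h⟩)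
  refine ⟨γ, ⟨?_, ?_, ?_, ?_, ?_, ?_, ?_, ?_, ?_⟩⟩
  · intro v
    cases γ v
    · exact hsub hc₂
    · exact hsub hc₁
  · intro a b _
    have := Finset.mem_Icc.1 hc₁
    simp only [Finset.mem_Icc]
    omega
  · intro v
    cases γ v
    · exact hP₂.trans hsub
    · exact hP₁.trans hsub
  · intro a b hab
    have := hγ a b hab
    revert this
    cases γ a <;> cases γ b <;> simp [hc, hc.symm]
  · intro a b b' h h' hne
    exact absurd (uniq a b b' h h') hne
  · intro a b _
    have h1 := Finset.mem_Icc.1 hc₁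
    have h2 := Finset.mem_Icc.1 hc₂
    cases γ a <;> simp only [cond_true, cond_false] <;> omega
  · intro v
    cases γ v
    · exact hcP₂
    · exact hcP₁
  · intro a b _
    cases γ a
    · exact fun h => absurd (Finset.mem_Icc.1 (hP₂ h)).1 (by omega)
    · exact fun h => absurd (Finset.mem_Icc.1 (hP₁ h)).1 (by omega)
  · intro a b hab
    rw [spokeProd_one, spokeProd_one]
    have := hγ a b hab
    revert this
    cases γ a <;> cases γ b <;> simp [hprod, hprod.symm]

variable [DecidableEq V]

/-- Spoke colorings containing a prescribed set `R` of spoke colors at every vertex. -/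
theorem exists_isSpokeColoring {D k n : ℕ} (hD : ∀ v, G.degree v ≤ D) {R : Finset ℕ}
    (hR : R ⊆ Finset.Icc 1 k) (hk : k = n + D + 3) (hRD : 2 * D + 1 + R.card ≤ k)
    (h : R.card + 1 = n ∧ D ≤ 2 ∨ R.card + 2 ≤ n ∧ D ≤ 3) :
    ∃ c g P, G.IsSpokeColoring k c g P ∧ ∀ v, R ⊆ P v ∧ (P v).card = n := by
  have hB : (Finset.Icc 1 k \ R).card = k - R.card := by
    rw [Finset.card_sdiff_of_subset hR, Nat.card_Icc]; omega
  obtain ⟨g, hg, hgg, -⟩ := exists_edge_coloring G hD (fun _ => Finset.Icc 1 k \ R) ∅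
    (fun _ => 1) (fun _ => 0) (by simp) (by simp) (by simp) (by
      intro a b _
      simp only [Finset.inter_empty, Finset.card_empty, hB]
      omega)
  replace hg : ∀ a b, G.Adj a b → g s(a, b) ∈ Finset.Icc 1 k \ R := fun a b hab => hg s(a, b) hab
  obtain ⟨c, hc, hcc⟩ := exists_assignment_of_extension G
    (fun v x => x ∈ Finset.Icc 1 k \ R ∧ ∀ a, G.Adj v a → x ≠ g s(v, a))
    (fun _ x _ y => x ≠ y) (fun _ _ _ _ h => h.symm) (by
      intro φ u
      have h1 := card_image_neighborFinset_le G hD u fun a => g s(u, a)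
      have h2 := card_image_neighborFinset_le G hD u φ
      have h3 := Finset.card_union_le ((G.neighborFinset u).image fun a => g s(u, a))
        ((G.neighborFinset u).image φ)
      obtain ⟨x, hx, hx'⟩ := Finset.exists_mem_notMem_of_card_lt_card
        (show (((G.neighborFinset u).image fun a => g s(u, a)) ∪
          ((G.neighborFinset u).image φ)).card < (Finset.Icc 1 k \ R).card by omega)
      simp only [Finset.mem_union, Finset.mem_image, mem_neighborFinset, not_or, not_exists,
        not_and] at hx'
      exact ⟨x, ⟨hx, fun a ha h => hx'.1 a ha h.symm⟩, fun a ha h => hx'.2 a ha h.symm⟩)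
  have pos : ∀ x ∈ Finset.Icc 1 k \ R, 0 < x := fun x hx =>
    (Finset.mem_Icc.1 (Finset.mem_sdiff.1 hx).1).1
  have hRpos : 0 < ∏ x ∈ R, x := Finset.prod_pos fun x hx => (Finset.mem_Icc.1 (hR hx)).1
  have hκ : ∀ v, 0 < c v * (∏ x ∈ R, x) * G.nbrProd g v := fun v =>
    Nat.mul_pos (Nat.mul_pos (pos _ (hc v).1) hRpos)
      (nbrProd_pos G fun a ha => pos _ (hg v a ha))
  -- Besides R, each vertex needs j = n - |R| spokes. Removing R, the color of the vertex and at
  -- most D edge colors from k = n + D + 3 leaves at least j + 2 candidates, while at most D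
  -- products are forbidden.
  obtain ⟨Q, hQ, hQQ⟩ := exists_assignment_of_extension G
    (fun v (Q : Finset ℕ) => Q ⊆ (Finset.Icc 1 k \ R) \ ({c v} ∪
      (G.neighborFinset v).image fun a => g s(v, a)) ∧ Q.card = n - R.card)
    (fun v Q w Q' => c v * (∏ x ∈ R, x) * G.nbrProd g v * ∏ x ∈ Q, x ≠
      c w * (∏ x ∈ R, x) * G.nbrProd g w * ∏ x ∈ Q', x) (fun _ _ _ _ h => h.symm) (by
      intro φ u
      have h1 := card_image_neighborFinset_le G hD u fun a => g s(u, a)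
      have h2 := card_image_neighborFinset_le G hD u fun w =>
        c w * (∏ x ∈ R, x) * G.nbrProd g w * (∏ x ∈ φ w, x) /
          (c u * (∏ x ∈ R, x) * G.nbrProd g u)
      have h3 := Finset.card_union_le {c u} ((G.neighborFinset u).image fun a => g s(u, a))
      have h4 := Finset.le_card_sdiff ({c u} ∪ (G.neighborFinset u).image fun a => g s(u, a))
        (Finset.Icc 1 k \ R)
      rw [Finset.card_singleton] at h3
      obtain ⟨Q, hQ1, hQ2, hQ3⟩ := exists_subset_prod_notMem (j := n - R.card)
        (A := (Finset.Icc 1 k \ R) \ ({c u} ∪ (G.neighborFinset u).image fun a => g s(u, a)))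
        (Y := (G.neighborFinset u).image fun w =>
          c w * (∏ x ∈ R, x) * G.nbrProd g w * (∏ x ∈ φ w, x) /
            (c u * (∏ x ∈ R, x) * G.nbrProd g u)) (by simp) (by omega)
      refine ⟨Q, ⟨hQ1, hQ2⟩, fun w huw hcon => hQ3 ?_⟩
      rw [Finset.mem_image]
      refine ⟨w, by simpa using huw, ?_⟩
      rw [← hcon, Nat.mul_div_cancel_left _ (hκ u)])
  have hQ' : ∀ v, ∀ x ∈ Q v, (x ∈ Finset.Icc 1 k ∧ x ∉ R) ∧ x ≠ c v ∧
      ∀ a, G.Adj v a → g s(v, a) ≠ x := by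
    intro v x hx
    simpa only [Finset.mem_sdiff, Finset.mem_union, Finset.mem_singleton, Finset.mem_image,
      mem_neighborFinset, not_or, not_exists, not_and] using (hQ v).1 hx
  have hRQ : ∀ v, Disjoint R (Q v) := fun v =>
    Finset.disjoint_right.2 fun x hx => (hQ' v x hx).1.2
  refine ⟨c, g, fun v => R ∪ Q v, ⟨fun v => (Finset.mem_sdiff.1 (hc v).1).1,
    fun a b hab => (Finset.mem_sdiff.1 (hg a b hab)).1, ?_, hcc, hgg, fun a b hab => (hc a).2 b hab,
    ?_, ?_, ?_⟩, fun v => ⟨Finset.subset_union_left, ?_⟩⟩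
  · intro v
    exact Finset.union_subset hR fun x hx => (hQ' v x hx).1.1
  · intro v hv
    rcases Finset.mem_union.1 hv with h | h
    · exact (Finset.mem_sdiff.1 (hc v).1).2 h
    · exact (hQ' v _ h).2.1 rfl
  · intro a b hab hm
    rcases Finset.mem_union.1 hm with h | h
    · exact (Finset.mem_sdiff.1 (hg a b hab)).2 h
    · exact (hQ' a _ h).2.2 b hab rfl
  · intro a b hab heq
    apply hQQ a b hab
    simp only [spokeProd, Finset.prod_union (hRQ _)] at heq
    linarith
  · rw [Finset.card_union_of_disjoint (hRQ v), (hQ v).2]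
    omega

/-- Spoke colorings of graphs of maximum degree two with nine colors and four spokes. -/
theorem exists_isSpokeColoring_four (hG : ∀ v, G.degree v ≤ 2) :
    ∃ c g, ∃ a : V → ℕ, G.IsSpokeColoring 9 c g (fun v => [2, 4, 9, a v].toFinset) ∧
      ∀ v, c v ∈ [5, 7, 6] ∧ a v ∈ [1, 3, 8] ∧ ∃ x ∈ listProds 3 [1, 3, 8],
        G.spokeProd c g (fun v => [2, 4, 9, a v].toFinset) v = c v * (72 * x) := by
  -- Three colors exceed the two adjacent edges, and one of them is unused at each vertex; it
  -- becomes the fourth spoke color a v.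
  obtain ⟨g, hg, hgg, -⟩ := exists_edge_coloring G hG (fun _ => {1, 3, 8}) ∅
    (fun _ => 1) (fun _ => 0) (by simp) (by simp) (by simp) (by simp)
  replace hg : ∀ a b, G.Adj a b → g s(a, b) ∈ ({1, 3, 8} : Finset ℕ) := fun a b h => hg s(a, b) h
  obtain ⟨c, hc, hcc⟩ := exists_assignment_of_extension G
    (fun v x => x ∈ ({5, 7, 6} : Finset ℕ)) (fun _ x _ y => x ≠ y) (fun _ _ _ _ h => h.symm) (by
      intro φ u
      obtain ⟨x, hx, hx'⟩ := Finset.exists_mem_notMem_of_card_lt_card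
        (show ((G.neighborFinset u).image φ).card < ({5, 7, 6} : Finset ℕ).card from
          (card_image_neighborFinset_le G hG u φ).trans_lt (by decide))
      simp only [Finset.mem_image, mem_neighborFinset, not_exists, not_and] at hx'
      exact ⟨x, hx, fun w hw h => hx' w hw h.symm⟩)
  have ha : ∀ v, ∃ x ∈ ({1, 3, 8} : Finset ℕ), ∀ b, G.Adj v b → g s(v, b) ≠ x := by
    intro v
    obtain ⟨x, hx, hx'⟩ := Finset.exists_mem_notMem_of_card_lt_card
      (show ((G.neighborFinset v).image fun b => g s(v, b)).card < ({1, 3, 8} : Finset ℕ).card from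
        (card_image_neighborFinset_le G hG v _).trans_lt (by decide))
    simp only [Finset.mem_image, mem_neighborFinset, not_exists, not_and] at hx'
    exact ⟨x, hx, hx'⟩
  choose a ha ha' using ha
  have hprod : ∀ v, ∃ x ∈ listProds 3 [1, 3, 8],
      G.spokeProd c g (fun v => [2, 4, 9, a v].toFinset) v = c v * (72 * x) := by
    intro v
    have hinj : Set.InjOn (fun b => g s(v, b)) (G.neighborFinset v : Set V) := by
      intro b hb b' hb' h
      by_contra hne
      exact hgg v b b' (by simpa using hb) (by simpa using hb') hne h
    have hnot : a v ∉ (G.neighborFinset v).image fun b => g s(v, b) := by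
      simpa using ha' v
    have hmem := prod_mem_listProds id [1, 3, 8]
      (insert (a v) ((G.neighborFinset v).image fun b => g s(v, b))) 3 (by
        intro x hx
        rcases Finset.mem_insert.1 hx with rfl | hx
        · simpa using ha v
        · obtain ⟨b, hb, rfl⟩ := Finset.mem_image.1 hx
          simpa using hg v b (by simpa using hb)) (by
        rw [Finset.card_insert_of_notMem hnot]
        have := card_image_neighborFinset_le G hG v fun b => g s(v, b)
        omega)
    rw [Finset.prod_insert hnot, Finset.prod_image hinj, List.map_id] at hmem
    refine ⟨_, hmem, ?_⟩
    have h1 : ∏ x ∈ [2, 4, 9, a v].toFinset, x = 72 * a v := by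
      have := ha v
      simp only [Finset.mem_insert, Finset.mem_singleton] at this
      rcases this with h | h | h <;> rw [h] <;> decide
    simp only [spokeProd, h1, id, nbrProd, mul_assoc]
  have hcl : ∀ v, c v ∈ [5, 7, 6] := fun v => by simpa using hc v
  have hal : ∀ v, a v ∈ [1, 3, 8] := fun v => by simpa using ha v
  have hgl : ∀ u v, G.Adj u v → g s(u, v) ∈ [1, 3, 8] := fun u v h => by simpa using hg u v h
  -- The primes 5 and 7 divide neither 72 nor any x, so divisibility of the product by 5 and by 7
  -- reveals the vertex color.
  have hne : ∀ c ∈ [5, 7, 6], ∀ c' ∈ [5, 7, 6], c ≠ c' → ∀ x ∈ listProds 3 [1, 3, 8],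
      ∀ x' ∈ listProds 3 [1, 3, 8], c * (72 * x) ≠ c' * (72 * x') := by decide +kernel
  have d1 : ∀ x ∈ [5, 7, 6], x ∈ Finset.Icc 1 9 := by decide
  have d2 : ∀ x ∈ [1, 3, 8], x ∈ Finset.Icc 1 9 ∧ [2, 4, 9, x].toFinset ⊆ Finset.Icc 1 9 := by
    decide
  have d3 : ∀ x ∈ [5, 7, 6], ∀ y ∈ [1, 3, 8], x ≠ y ∧ x ∉ [2, 4, 9, y].toFinset := by decide
  have d4 : ∀ x ∈ [1, 3, 8], ∀ y ∈ [1, 3, 8], x ≠ y → x ∉ [2, 4, 9, y].toFinset := by decide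
  refine ⟨c, g, a, ⟨fun v => d1 _ (hcl v), fun u v h => (d2 _ (hgl u v h)).1,
    fun v => (d2 _ (hal v)).2, hcc, hgg, fun u v h => (d3 _ (hcl u) _ (hgl u v h)).1,
    fun v => (d3 _ (hcl v) _ (hal v)).2,
    fun u v h => d4 _ (hgl u v h) _ (hal u) (ha' u v h), ?_⟩, fun v => ⟨hcl v, hal v, hprod v⟩⟩
  intro u v huv
  obtain ⟨x, hx, h1⟩ := hprod u
  obtain ⟨y, hy, h2⟩ := hprod v
  rw [h1, h2]
  exact hne _ (hcl u) _ (hcl v) (hcc u v huv) x hx y hy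

/-- One of the two ways to pair {a, b} with {x, y} has unequal entries in both pairs. If neither
pair of that matching admitted p ≠ q, then P a and P b would each lie in a singleton, and their
union would have at most two elements. -/
theorem exists_ne_and_mem_ne {a b x y : ℕ} (hab : a ≠ b) (hxy : x ≠ y) {P Q : ℕ → Finset ℕ}
    (hP : 3 ≤ (P a ∪ P b).card) (hQx : (Q x).Nonempty) (hQy : (Q y).Nonempty) :
    ∃ c, (c = a ∨ c = b) ∧ ∃ d, (d = x ∨ d = y) ∧ c ≠ d ∧ ∃ p ∈ P c, ∃ q ∈ Q d, p ≠ q := by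
  have key : ∀ {x y}, (Q x).Nonempty → (Q y).Nonempty → a ≠ x → b ≠ y →
      ∃ c, (c = a ∨ c = b) ∧ ∃ d, (d = x ∨ d = y) ∧ c ≠ d ∧ ∃ p ∈ P c, ∃ q ∈ Q d, p ≠ q := by
    rintro x y ⟨q, hq⟩ ⟨q', hq'⟩ hax hby
    by_contra hcon
    have h1 : P a ⊆ {q} := fun p hp => by
      by_contra h
      exact hcon ⟨a, Or.inl rfl, x, Or.inl rfl, hax, p, hp, q, hq, by simpa using h⟩
    have h2 : P b ⊆ {q'} := fun p hp => by
      by_contra h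
      exact hcon ⟨b, Or.inr rfl, y, Or.inr rfl, hby, p, hp, q', hq', by simpa using h⟩
    have h3 := Finset.card_le_card (Finset.union_subset_union h1 h2)
    have h4 := Finset.card_union_le ({q} : Finset ℕ) {q'}
    simp only [Finset.card_singleton] at h4
    omega
  by_cases h : a ≠ x ∧ b ≠ y
  · exact key hQx hQy h.1 h.2
  · obtain ⟨c, hc, d, hd, h⟩ := key hQy hQx (x := y) (y := x) (by omega) (by omega)
    exact ⟨c, hc, d, hd.symm, h⟩

/-- In a set of four numbers with different products of pairs, there are many choices of a pair
when two values of the first entry and two values of the product are forbidden. -/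
theorem exists_pair_products {A F Y : Finset ℕ} {κ : ℕ} (hκ : 0 < κ) (hA : A.card = 4)
    (h0 : 0 ∉ A)
    (hinj : ∀ x ∈ A, ∀ y ∈ A, ∀ z ∈ A, ∀ w ∈ A, x ≠ y → z ≠ w → x * y = z * w → x = z ∨ x = w)
    (hF : F.card ≤ 2) (hY : Y.card ≤ 2) :
    ∃ a ∈ A \ F, ∃ b ∈ A \ F, a ≠ b ∧ ∃ P : ℕ → Finset ℕ,
      (∀ c, P c = ((A.erase c).image fun s => κ * (c * s)) \ Y) ∧ 3 ≤ (P a ∪ P b).card ∧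
      (P a).Nonempty ∧ (P b).Nonempty := by
  have hAF : 1 < (A \ F).card := by
    have := Finset.le_card_sdiff F A
    omega
  obtain ⟨a, ha, b, hb, hab⟩ := Finset.one_lt_card.1 hAF
  have haA := (Finset.mem_sdiff.1 ha).1
  have hbA := (Finset.mem_sdiff.1 hb).1
  have pos : ∀ x ∈ A, 0 < x := fun x hx => Nat.pos_of_ne_zero fun h => h0 (h ▸ hx)
  have hI : ∀ c ∈ A, ((A.erase c).image fun s => κ * (c * s)).card = 3 := by
    intro c hc
    rw [Finset.card_image_of_injective, Finset.card_erase_of_mem hc, hA]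
    intro x y hxy
    exact Nat.eq_of_mul_eq_mul_left (pos c hc) (Nat.eq_of_mul_eq_mul_left hκ hxy)
  have hne : ∀ c ∈ A, (((A.erase c).image fun s => κ * (c * s)) \ Y).Nonempty := by
    intro c hc
    rw [← Finset.card_pos]
    have h1 := Finset.le_card_sdiff Y ((A.erase c).image fun s => κ * (c * s))
    rw [hI c hc] at h1
    omega
  refine ⟨a, ha, b, hb, hab, _, fun _ => rfl, ?_, hne a haA, hne b hbA⟩
  -- Each first entry gives three products and the two families share at most κab. Hence there are
  -- at least five products, of which Y removes at most two.
  rw [← Finset.union_sdiff_distrib]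
  have h1 := Finset.le_card_sdiff Y (((A.erase a).image fun s => κ * (a * s)) ∪
    ((A.erase b).image fun s => κ * (b * s)))
  have h2 := Finset.card_union_add_card_inter ((A.erase a).image fun s => κ * (a * s))
    ((A.erase b).image fun s => κ * (b * s))
  have h3 : (((A.erase a).image fun s => κ * (a * s)) ∩
      ((A.erase b).image fun s => κ * (b * s))).card ≤ 1 := by
    refine (Finset.card_le_card (t := {κ * (a * b)}) ?_).trans (by simp)
    intro x hx
    obtain ⟨hx1, hx2⟩ := Finset.mem_inter.1 hx
    obtain ⟨s, hs, rfl⟩ := Finset.mem_image.1 hx1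
    obtain ⟨r, hr, hrs⟩ := Finset.mem_image.1 hx2
    obtain ⟨hsa, hsA⟩ := Finset.mem_erase.1 hs
    obtain ⟨hrb, hrA⟩ := Finset.mem_erase.1 hr
    have heq := Nat.eq_of_mul_eq_mul_left hκ hrs
    rcases hinj b hbA r hrA a haA s hsA hrb.symm hsa.symm heq with h | h
    · exact absurd h.symm hab
    · simp [h]
  rw [hI a haA, hI b hbA] at h2
  omega

/-- Spoke colorings of subcubic graphs with seven colors and one spoke. -/
theorem exists_isSpokeColoring_one (hG : ∀ v, G.degree v ≤ 3) :
    ∃ c g P, G.IsSpokeColoring 7 c g P ∧ ∀ v, (P v).card = 1 := by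
  -- Five colors suffice for the edges, since each has at most four adjacent ones. At every vertex
  -- two of these colors p, q stay unused; with 5 and 7 they form a set whose pairs have distinct
  -- products.
  obtain ⟨g, hg, hgg, -⟩ := exists_edge_coloring G hG (fun _ => {1, 2, 3, 4, 6}) ∅
    (fun _ => 1) (fun _ => 0) (by simp) (by simp) (by simp) (by simp)
  replace hg : ∀ a b, G.Adj a b → g s(a, b) ∈ ({1, 2, 3, 4, 6} : Finset ℕ) :=
    fun a b h => hg s(a, b) h
  have hA : ∀ v, ∃ A ⊆ Finset.Icc 1 7, A.card = 4 ∧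
      (∀ x ∈ A, ∀ y ∈ A, ∀ z ∈ A, ∀ w ∈ A, x ≠ y → z ≠ w → x * y = z * w → x = z ∨ x = w) ∧
      ∀ b, G.Adj v b → g s(v, b) ∉ A := by
    intro v
    have h1 := card_image_neighborFinset_le G hG v fun b => g s(v, b)
    have h2 := Finset.le_card_sdiff ((G.neighborFinset v).image fun b => g s(v, b))
      ({1, 2, 3, 4, 6} : Finset ℕ)
    rw [show ({1, 2, 3, 4, 6} : Finset ℕ).card = 5 from rfl] at h2
    obtain ⟨p, hp, q, hq, hpq⟩ := Finset.one_lt_card.1 (show 1 < (({1, 2, 3, 4, 6} : Finset ℕ) \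
      ((G.neighborFinset v).image fun b => g s(v, b))).card by omega)
    simp only [Finset.mem_sdiff, Finset.mem_image, mem_neighborFinset, not_exists, not_and]
      at hp hq
    have hdec : ∀ p ∈ ({1, 2, 3, 4, 6} : Finset ℕ), ∀ q ∈ ({1, 2, 3, 4, 6} : Finset ℕ), p ≠ q →
        ({5, 7, p, q} : Finset ℕ) ⊆ Finset.Icc 1 7 ∧ ({5, 7, p, q} : Finset ℕ).card = 4 ∧
        ∀ x ∈ ({5, 7, p, q} : Finset ℕ), ∀ y ∈ ({5, 7, p, q} : Finset ℕ),
          ∀ z ∈ ({5, 7, p, q} : Finset ℕ), ∀ w ∈ ({5, 7, p, q} : Finset ℕ),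
          x ≠ y → z ≠ w → x * y = z * w → x = z ∨ x = w := by decide +kernel
    obtain ⟨d1, d2, d3⟩ := hdec p hp.1 q hq.1 hpq
    refine ⟨{5, 7, p, q}, d1, d2, d3, fun b hb hm => ?_⟩
    have h57 : ∀ x ∈ ({1, 2, 3, 4, 6} : Finset ℕ), x ≠ 5 ∧ x ≠ 7 := by decide
    simp only [Finset.mem_insert, Finset.mem_singleton] at hm
    rcases hm with h | h | h | h
    · exact (h57 _ (hg v b hb)).1 h
    · exact (h57 _ (hg v b hb)).2 h
    · exact hp.2 b hb h
    · exact hq.2 b hb h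
  choose A hA7 hA4 hAinj hAg using hA
  have hA0 : ∀ v, 0 ∉ A v := fun v h => by simpa using hA7 v h
  have hκ : ∀ v, 0 < G.nbrProd g v := fun v => nbrProd_pos G fun a ha =>
    Nat.pos_of_ne_zero fun h => by simpa [h] using hg v a ha
  -- The value at v is the pair (vertex color, spoke color). For two adjacent vertices chosen
  -- together, each has at most two other neighbors, which forbid at most two colors and two
  -- products.
  obtain ⟨φ, hφ, hφφ⟩ := exists_assignment_of_pair_extension G
    (fun v (x : ℕ × ℕ) => x.1 ∈ A v ∧ x.2 ∈ (A v).erase x.1)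
    (fun v x w y => x.1 ≠ y.1 ∧
      G.nbrProd g v * (x.1 * x.2) ≠ G.nbrProd g w * (y.1 * y.2))
    (fun _ _ _ _ h => ⟨h.1.symm, h.2.symm⟩) (by
      intro v
      obtain ⟨x, hx, y, hy, hxy⟩ := Finset.one_lt_card.1 (show 1 < (A v).card by
        rw [hA4]; omega)
      exact ⟨(x, y), hx, Finset.mem_erase.2 ⟨hxy.symm, hy⟩⟩) (by
      intro φ u v huv
      have hc : ∀ u v, G.Adj u v → ∀ h : V → ℕ,
          (((G.neighborFinset u).erase v).image h).card ≤ 2 := by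
        intro u v huv h
        refine Finset.card_image_le.trans ?_
        rw [Finset.card_erase_of_mem (by simpa using huv), card_neighborFinset_eq_degree]
        have := hG u
        omega
      obtain ⟨a, ha, b, hb, hab, P, hP, hP3, -, -⟩ := exists_pair_products (hκ u) (hA4 u)
        (hA0 u) (hAinj u) (hc u v huv fun w => (φ w).1)
        (hc u v huv fun w => G.nbrProd g w * ((φ w).1 * (φ w).2))
      obtain ⟨a', ha', b', hb', hab', P', hP', -, hPa', hPb'⟩ := exists_pair_products (hκ v)
        (hA4 v) (hA0 v) (hAinj v) (hc v u huv.symm fun w => (φ w).1)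
        (hc v u huv.symm fun w => G.nbrProd g w * ((φ w).1 * (φ w).2))
      obtain ⟨c, hca, d, hda, hcd, p, hp, q, hq, hpq⟩ :=
        exists_ne_and_mem_ne hab hab' hP3 hPa' hPb'
      replace hca : c ∈ A u \ ((G.neighborFinset u).erase v).image fun w => (φ w).1 := by
        rcases hca with rfl | rfl <;> assumption
      replace hda : d ∈ A v \ ((G.neighborFinset v).erase u).image fun w => (φ w).1 := by
        rcases hda with rfl | rfl <;> assumption
      rw [hP, Finset.mem_sdiff, Finset.mem_image] at hp
      rw [hP', Finset.mem_sdiff, Finset.mem_image] at hq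
      obtain ⟨⟨s, hs, rfl⟩, hsY⟩ := hp
      obtain ⟨⟨r, hr, rfl⟩, hrY⟩ := hq
      simp only [Finset.mem_sdiff, Finset.mem_image, Finset.mem_erase (a := _) (b := u),
        Finset.mem_erase (a := _) (b := v), mem_neighborFinset, not_exists, not_and,
        and_imp] at hca hda hsY hrY
      exact ⟨(c, s), (d, r), ⟨hca.1, hs⟩, ⟨hda.1, hr⟩, ⟨hcd, hpq⟩,
        fun w hw hwv => ⟨fun h => hca.2 w hwv hw h.symm, fun h => hsY w hwv hw h.symm⟩,
        fun w hw hwu => ⟨fun h => hda.2 w hwu hw h.symm, fun h => hrY w hwu hw h.symm⟩⟩)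
  have hφ2 : ∀ v, (φ v).2 ∈ A v := fun v => Finset.mem_of_mem_erase (hφ v).2
  refine ⟨fun v => (φ v).1, g, fun v => {(φ v).2}, ⟨fun v => hA7 v (hφ v).1, ?_, ?_, ?_, hgg, ?_,
    ?_, ?_, ?_⟩, fun v => Finset.card_singleton _⟩
  · intro a b hab
    have : ∀ x ∈ ({1, 2, 3, 4, 6} : Finset ℕ), x ∈ Finset.Icc 1 7 := by decide
    exact this _ (hg a b hab)
  · intro v
    simpa using hA7 v (hφ2 v)
  · exact fun a b hab => (hφφ a b hab).1
  · exact fun a b hab h => hAg a b hab (h ▸ (hφ a).1)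
  · intro v h
    exact Finset.ne_of_mem_erase (hφ v).2 (Finset.mem_singleton.1 h).symm
  · intro a b hab h
    rw [Finset.mem_singleton] at h
    exact hAg a b hab (h ▸ hφ2 a)
  · intro a b hab h
    apply (hφφ a b hab).2
    simp only [spokeProd, Finset.prod_singleton] at h
    linarith

end spokes

/-! ### Case distinction and conclusion -/

section corona

variable {V W : Type*} [Fintype V] [DecidableEq V] [Fintype W] [DecidableEq W]
  (G : SimpleGraph V) [DecidableRel G.Adj] (H : SimpleGraph W) [DecidableRel H.Adj]

theorem exists_isNPDTotalColoring_corona_of_universal (hG : ∀ v, G.degree v ≤ 0)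
    (hH : ∀ w, H.degree w ≤ 3) {n k c t : ℕ} (hn : Fintype.card W = n) {f s : List ℕ}
    {e : List (List ℕ)} (hu : IsUniversalColoring n k c t f s e) (hs : s.length = n)
    (hc : c ∈ Finset.Icc 1 k) (hP : s.toFinset ⊆ Finset.Icc 1 k) (hcP : c ∉ s.toFinset)
    (ht : c * ∏ x ∈ s.toFinset, x = t) : ∃ f g, (G.corona H).IsNPDTotalColoring k f g := by
  refine exists_isNPDTotalColoring_corona G H (isSpokeColoring_const G hG hc hP hcP) fun v => ?_
  rw [spokeProd_one, ht]
  exact hasCopyColoring_of_universal H hH hn hu hs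

theorem exists_isNPDTotalColoring_corona_of_universal_pair (hG : ∀ v, G.degree v ≤ 1)
    (hH : ∀ w, H.degree w ≤ 3) {n k c₁ c₂ t₁ t₂ : ℕ} (hn : Fintype.card W = n)
    {f₁ s₁ f₂ s₂ : List ℕ} {e₁ e₂ : List (List ℕ)}
    (hu₁ : IsUniversalColoring n k c₁ t₁ f₁ s₁ e₁) (hu₂ : IsUniversalColoring n k c₂ t₂ f₂ s₂ e₂)
    (hs₁ : s₁.length = n) (hs₂ : s₂.length = n)
    (hc₁ : c₁ ∈ Finset.Icc 2 k) (hc₂ : c₂ ∈ Finset.Icc 2 k) (hP₁ : s₁.toFinset ⊆ Finset.Icc 2 k)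
    (hP₂ : s₂.toFinset ⊆ Finset.Icc 2 k) (hcP₁ : c₁ ∉ s₁.toFinset) (hcP₂ : c₂ ∉ s₂.toFinset)
    (hc : c₁ ≠ c₂) (ht₁ : c₁ * ∏ x ∈ s₁.toFinset, x = t₁) (ht₂ : c₂ * ∏ x ∈ s₂.toFinset, x = t₂)
    (ht : t₁ ≠ t₂) : ∃ f g, (G.corona H).IsNPDTotalColoring k f g := by
  obtain ⟨γ, hγ⟩ := exists_isSpokeColoring_cond G hG hc₁ hc₂ hP₁ hP₂ hcP₁ hcP₂ hc
    (by rwa [ht₁, ht₂])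
  refine exists_isNPDTotalColoring_corona G H hγ fun v => ?_
  rw [spokeProd_one]
  cases γ v
  · rw [cond_false, cond_false, ht₂]
    exact hasCopyColoring_of_universal H hH hn hu₂ hs₂
  · rw [cond_true, cond_true, ht₁]
    exact hasCopyColoring_of_universal H hH hn hu₁ hs₁

theorem exists_isNPDTotalColoring_corona_of_small {n d : ℕ} (hG : ∀ v, G.degree v ≤ d)
    (hH : ∀ w, H.degree w ≤ 3) (hn : Fintype.card W = n)
    (h : d = 0 ∧ 2 ≤ n ∧ n ≤ 6 ∨ d = 1 ∧ 3 ≤ n ∧ n ≤ 5 ∨ d = 2 ∧ n = 4) :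
    ∃ f g, (G.corona H).IsNPDTotalColoring (n + d + 3) f g := by
  rcases h with ⟨rfl, h1, h2⟩ | ⟨rfl, h1, h2⟩ | ⟨rfl, rfl⟩
  · interval_cases n
    · exact exists_isNPDTotalColoring_corona_of_universal G H hG hH hn isUniversalColoring_two_five
        rfl (by decide) (by decide) (by decide) (by decide)
    · exact exists_isNPDTotalColoring_corona_of_universal G H hG hH hn isUniversalColoring_three_six
        rfl (by decide) (by decide) (by decide) (by decide)
    · exact exists_isNPDTotalColoring_corona_of_universal G H hG hH hn
        isUniversalColoring_four_seven rfl (by decide) (by decide) (by decide) (by decide)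
    · exact exists_isNPDTotalColoring_corona_of_universal G H hG hH hn
        isUniversalColoring_five_eight rfl (by decide) (by decide) (by decide) (by decide)
    · exact exists_isNPDTotalColoring_corona_of_universal G H hG hH hn
        isUniversalColoring_six_nine rfl (by decide) (by decide) (by decide) (by decide)
  · interval_cases n
    · exact exists_isNPDTotalColoring_corona_of_universal_pair G H hG hH hn
        isUniversalColoring_three_seven_left isUniversalColoring_three_seven_right rfl rfl
        (by decide) (by decide) (by decide) (by decide) (by decide) (by decide) (by decide)
        (by decide) (by decide) (by decide)
    · exact exists_isNPDTotalColoring_corona_of_universal_pair G H hG hH hn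
        isUniversalColoring_four_eight_left isUniversalColoring_four_eight_right rfl rfl
        (by decide) (by decide) (by decide) (by decide) (by decide) (by decide) (by decide)
        (by decide) (by decide) (by decide)
    · exact exists_isNPDTotalColoring_corona_of_universal_pair G H hG hH hn
        isUniversalColoring_five_nine_left isUniversalColoring_five_nine_right rfl rfl
        (by decide) (by decide) (by decide) (by decide) (by decide) (by decide) (by decide)
        (by decide) (by decide) (by decide)
  · obtain ⟨c, g, a, hg, h⟩ := exists_isSpokeColoring_four G hG
    refine exists_isNPDTotalColoring_corona G H hg fun v => ?_
    obtain ⟨hc, ha, x, hx, ht⟩ := h v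
    rw [ht]
    exact hasCopyColoring_of_universal H hH hn
      (isUniversalColoring_four_nine (c v) hc (a v) ha x hx) rfl

theorem exists_isNPDTotalColoring_corona_of_subcubic [Nonempty V] [Nonempty W]
    (hG : G.maxDegree ≤ 3) (hH : H.maxDegree ≤ 3) :
    ∃ f g, (G.corona H).IsNPDTotalColoring (Fintype.card W + G.maxDegree + 3) f g := by
  have hGd := G.degree_le_maxDegree
  have hHd := H.degree_le_maxDegree
  have hlt : H.maxDegree < Fintype.card W := H.maxDegree_lt_card_verts
  generalize hk : Fintype.card W + G.maxDegree + 3 = k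
  generalize hd : G.maxDegree = d at *
  generalize hD : H.maxDegree = D at *
  generalize hn : Fintype.card W = n at *
  by_cases h1 : n = 1 ∧ d = 3
  · obtain ⟨rfl, rfl⟩ := h1
    obtain rfl : 7 = k := hk
    obtain ⟨c, g, P, h, hP⟩ := exists_isSpokeColoring_one G hGd
    exact exists_isNPDTotalColoring_corona G H h fun v =>
      hasCopyColoring_of_le H hHd (h.spoke_mem v) (by rw [hP v, hn]) (by omega) (by omega)
  by_cases h2 : 3 * D + 3 ≤ k
  · obtain ⟨c, g, P, h, hP⟩ := exists_isSpokeColoring G hGd (Finset.empty_subset _) hk.symm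
      (by rw [Finset.card_empty]; omega) (by rw [Finset.card_empty]; omega)
    exact exists_isNPDTotalColoring_corona G H h fun v =>
      hasCopyColoring_of_le H hHd (h.spoke_mem v) (by rw [(hP v).2, hn]) h2 (by omega)
  by_cases h3 : 3 * D + 1 ≤ k ∧ 2 * D + 4 ≤ k ∧ 3 ≤ n
  · obtain ⟨p, hp, hp1, hp2⟩ := Nat.exists_prime_lt_and_le_two_mul (k / 2) (by omega)
    obtain ⟨c, g, P, h, hP⟩ := exists_isSpokeColoring G hGd (R := {p}) (k := k)
      (by
        have := hp.pos
        simp only [Finset.singleton_subset_iff, Finset.mem_Icc]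
        omega) hk.symm
      (by rw [Finset.card_singleton]; omega) (by rw [Finset.card_singleton]; omega)
    have hpP : ∀ v, p ∈ P v := fun v => (hP v).1 (Finset.mem_singleton_self p)
    obtain ⟨w, hw⟩ := H.exists_maximal_degree_vertex
    obtain ⟨w', hw'⟩ := (H.degree_pos_iff_exists_adj w).1 (by omega)
    exact exists_isNPDTotalColoring_corona G H h fun v =>
      hasCopyColoring_of_prime H hHd (h.spoke_mem v) (by rw [(hP v).2, hn]) hp (hpP v)
        (fun hc => h.vertex_notMem v (hc ▸ hpP v)) (by omega)
        (Dvd.dvd.mul_left (Dvd.dvd.mul_right (Finset.dvd_prod_of_mem _ (hpP v)) _) _)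
        ⟨w, w', hw'⟩ h3.1 h3.2.1
  rw [← hk]
  -- With D < n, the failed bounds leave D = 1 with n = 2, d = 0; D = 2 with n + d ≤ 4; and D = 3
  -- with n + d ≤ 6.
  exact exists_isNPDTotalColoring_corona_of_small G H hGd (fun w => (hHd w).trans hH) hn (by omega)

end corona

end SimpleGraph

theorem theorem1 {V W : Type*} [Fintype V] [DecidableEq V] [Nonempty V]
    [Fintype W] [DecidableEq W] [Nonempty W]
    (G : SimpleGraph V) [DecidableRel G.Adj] (H : SimpleGraph W) [DecidableRel H.Adj]
    (hG : G.maxDegree ≤ 3) (hH : H.maxDegree ≤ 3) :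
    (G.corona H).npdTotalChromaticNumber ≤ ((G.corona H).maxDegree + 3 : ℕ) := by
  have h := SimpleGraph.exists_isNPDTotalColoring_corona_of_subcubic G H hG hH
  have hle := SimpleGraph.maxDegree_corona_le G H
  refine (iInf₂_le _ ⟨?_, h⟩).trans (Nat.cast_le.2 ?_) <;> omega
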